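/- Let $n\ge 1$. Modules are right modules, so a product $fg$ of operators or functions means "first $f$, then $g$". Let $\mathbb{C}\mathfrak{S}_n$ be the vector space with basis the permutations $\mu=(\mu_1,\dots,\mu_n)$ of $\{1,\dots,n\}$. For $1\le i\le n-1$ let $\sigma_i$, $\pi_i$, $\bar\pi_i$ be the operators on it that, respectively, exchange the entries of $\mu$ at positions $i,i+1$, sort these two entries decreasingly, and sort them increasingly. Let $\mathrm{H}\mathfrak{S}_n\subset\mathrm{End}(\mathbb{C}\mathfrak{S}_n)$ be the algebra generated by all $\sigma_i$ and $\pi_i$ (it contains $\bar\pi_i=1+\sigma_i-\pi_i$ and right multiplication by every permutation), and for $q\in\mathbb{C}$ let $H_n(q)\subset\mathrm{H}\mathfrak{S}_n$ be the subalgebra generated by the $T_i=(q-1)(1-\pi_i)+q\sigma_i$. For a composition $I$ of $n$ let $P_I\subset\mathbb{C}\mathfrak{S}_n$ be the $\mathrm{H}\mathfrak{S}_n$-submodule of the vectors that change sign under exchanging the values $i$ and $i+1$, for every $i\in\{1,\dots,n-1\}\setminus\mathrm{Des}(I)$, where $\mathrm{Des}(I)$ is the set of proper partial sums of $I$. For $1\le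 k\le n$ let $P_n^k$ be either (a) $P_{(k,1,\dots,1)}/\sum P_{(k,1,\dots,1,2,1,\dots,1)}$, or (b) $P_{(1,\dots,1,k)}/\sum P_{(1,\dots,1,2,1,\dots,1,k)}$ (the same choice for all $k$). Let $\rho$ be the representation of $\mathrm{H}\mathfrak{S}_n$ on $\bigoplus_{k=1}^n P_n^k$. Let $\mathrm{NDF}_n$ be the monoid of nondecreasing functions from $\{1,\dots,n\}$ to itself, and $\mathrm{NDPF}_n$ its submonoid of nondecreasing parking functions (those with $f(i)\le i$ for all $i$). Let $p_i\in\mathrm{NDPF}_n$ be the function with $i+1\mapsto i$ fixing all other points, and $\bar p_i\in\mathrm{NDF}_n$ the function with $i\mapsto i+1$ fixing all other points. The algebra $\mathbb{C}[\mathrm{NDF}_n]$ acts on $\bigwedge^k\mathbb{C}^n$ by $(x_1\wedge\dots\wedge x_k)\cdot f=(x_1\cdot f)\wedge\dots\wedge(x_k\cdot f)$, where $e_i\cdot f=e_{f(i)}$. Then, for either choice of the modules $P_n^k$: 1. The representation of $\mathbb{C}[\mathrm{NDF}_n]$ on $\bigoplus_{k=1}^n\bigwedge^k\mathbb{C}^n$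 is faithful. 2. There are a surjective algebra morphism $\Phi:\mathrm{H}\mathfrak{S}_n\to\mathbb{C}[\mathrm{NDF}_n]$ with $\ker\Phi=\ker\rho$ and linear isomorphisms $E_k:P_n^k\to\bigwedge^k\mathbb{C}^n$ ($1\le k\le n$) with $E_k(x\cdot h)=E_k(x)\cdot\Phi(h)$ for all $h\in\mathrm{H}\mathfrak{S}_n$. Here $\Phi(\pi_i)=\bar p_i$ and $\Phi(\bar\pi_i)=p_i$ in case (a), while $\Phi(\pi_i)=p_i$ and $\Phi(\bar\pi_i)=\bar p_i$ in case (b). So $\mathbb{C}[\mathrm{NDF}_n]$ is the quotient of $\mathrm{H}\mathfrak{S}_n$ through its representation $\rho$ on exterior powers. 3. (Restriction to $\mathbb{C}[\mathfrak{S}_n]$.) The same $E_k$ satisfy $E_k(x\cdot\tau)=\left(\bigwedge^k\tau^{-1}\right)(E_k(x))$ for every $\tau\in\mathfrak{S}_n$, where $\tau^{-1}$ acts on $\mathbb{C}^n$ by $e_i\mapsto e_{\tau^{-1}(i)}$. That is, $\rho$ restricts to the usual representation of $\mathfrak{S}_n$ on exterior powers, written as a right action. 4. (Restriction to $H_n(0)$.)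 There is an algebra isomorphism $\mathbb{C}[\mathrm{NDPF}_n]\to\rho(H_n(0))$ sending $p_{n-i}$ to $\rho(\pi_i)$ in case (a), and $p_i$ to $\rho(\pi_i)$ in case (b), for all $i$. In case (b), moreover, $\Phi(H_n(0))$ is the subalgebra $\mathbb{C}[\mathrm{NDPF}_n]$ of $\mathbb{C}[\mathrm{NDF}_n]$. 5. (Restriction to $H_n(-1)$.) Let $\mathrm{TL}_n(0)$ be the Temperley–Lieb algebra with loop parameter $0=q^{1/2}+q^{-1/2}$ at $q=-1$, that is, the algebra with generators $e_1,\dots,e_{n-1}$ and relations $e_i^2=0$, $e_ie_je_i=e_i$ for $|i-j|=1$, and $e_ie_j=e_je_i$ for $|i-j|\ge2$. There is an algebra isomorphism $\mathrm{TL}_n(0)\to\rho(H_n(-1))$ sending $e_i$ to $\rho(\sqrt{-1}\,(1+T_i))$ for all $i$. -/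

import Mathlib

open MulOpposite
open scoped DirectSum

namespace HeckeSym

/-! Conventions.  Modules are right modules: the product `f g` of two operators is `g ∘ f`.
Hence operator algebras live in `(Module.End ℂ V)ᵐᵒᵖ`, and a right module over `A` is an algebra
morphism `A →ₐ[ℂ] (Module.End ℂ V)ᵐᵒᵖ`.  The set `{1, …, n}` is `Fin n`, and the indices
`1 ≤ i ≤ n - 1` of the generators are the elements of `Fin (n - 1)`; all indices are thus shifted
by one. -/

/-- The linear operator `e_x ↦ e_{f x}` on the space with canonical basis indexed by `ι`. -/
noncomputable def linearize {ι : Type} [Fintype ι] [DecidableEq ι] (f : ι → ι) :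
    Module.End ℂ (ι → ℂ) :=
  (Pi.basisFun ℂ ι).constr ℂ (fun x => Pi.single (f x) 1)

section linearize

variable {ι : Type} [Fintype ι] [DecidableEq ι]

theorem linearize_single (f : ι → ι) (x : ι) :
    linearize f (Pi.single x 1) = Pi.single (f x) 1 := by
  have h := (Pi.basisFun ℂ ι).constr_basis ℂ (fun x => (Pi.single (f x) 1 : ι → ℂ)) x
  rwa [Pi.basisFun_apply] at h

theorem end_ext {f g : Module.End ℂ (ι → ℂ)}
    (h : ∀ x : ι, f (Pi.single x 1) = g (Pi.single x 1)) : f = g :=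
  (Pi.basisFun ℂ ι).ext fun x => by rw [Pi.basisFun_apply]; exact h x

theorem linearize_comp (f g : ι → ι) : linearize (f ∘ g) = linearize f ∘ₗ linearize g :=
  end_ext fun x => by
    rw [LinearMap.comp_apply, linearize_single, linearize_single, linearize_single,
      Function.comp_apply]

theorem linearize_id : linearize (id : ι → ι) = LinearMap.id :=
  end_ext fun x => by rw [linearize_single]; rfl

end linearize

/-- The element `i` of `{1, …, n}`, for `1 ≤ i ≤ n - 1`. -/
def lo {n : ℕ} (i : Fin (n - 1)) : Fin n := ⟨i, by omega⟩

/-- The element `i + 1` of `{1, …, n}`, for `1 ≤ i ≤ n - 1`. -/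
def hi {n : ℕ} (i : Fin (n - 1)) : Fin n := ⟨i + 1, by omega⟩

theorem lo_lt_hi {n : ℕ} (i : Fin (n - 1)) : lo i < hi i := by
  simp [lo, hi]

/-- The elementary transposition exchanging `i` and `i + 1`. -/
def transp {n : ℕ} (i : Fin (n - 1)) : Equiv.Perm (Fin n) := Equiv.swap (lo i) (hi i)

/-! ### The algebra `H𝔖ₙ` -/

/-- The vector space `ℂ𝔖ₙ` with basis the permutations. -/
abbrev PermSpace (n : ℕ) : Type := Equiv.Perm (Fin n) → ℂ

/-- Right multiplication by the permutation `τ` (action on positions). -/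
noncomputable def permOp {n : ℕ} (τ : Equiv.Perm (Fin n)) : Module.End ℂ (PermSpace n) :=
  linearize (fun μ => μ * τ)

/-- Elementary decreasing sort at the positions `i`, `i + 1`. -/
noncomputable def sortOp {n : ℕ} (i : Fin (n - 1)) : Module.End ℂ (PermSpace n) :=
  linearize (fun μ => if μ (hi i) < μ (lo i) then μ else μ * transp i)

/-- Elementary increasing sort at the positions `i`, `i + 1`. -/
noncomputable def sortBarOp {n : ℕ} (i : Fin (n - 1)) : Module.End ℂ (PermSpace n) :=
  linearize (fun μ => if μ (lo i) < μ (hi i) then μ else μ * transp i)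

/-- Left multiplication by an elementary transposition (action on values). -/
noncomputable def leftOp {n : ℕ} (i : Fin (n - 1)) : Module.End ℂ (PermSpace n) :=
  linearize (fun μ => transp i * μ)

/-- The algebra `H𝔖ₙ` generated by the elementary transpositions and the elementary decreasing
sorts. -/
noncomputable def HS (n : ℕ) : Subalgebra ℂ (Module.End ℂ (PermSpace n))ᵐᵒᵖ :=
  Algebra.adjoin ℂ
    (Set.range (fun i : Fin (n - 1) => op (permOp (transp i))) ∪
      Set.range (fun i : Fin (n - 1) => op (sortOp i)))

theorem permOp_transp_mem {n : ℕ} (i : Fin (n - 1)) : op (permOp (transp i)) ∈ HS n :=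
  Algebra.subset_adjoin (Or.inl ⟨i, rfl⟩)

theorem sortOp_mem {n : ℕ} (i : Fin (n - 1)) : op (sortOp i) ∈ HS n :=
  Algebra.subset_adjoin (Or.inr ⟨i, rfl⟩)

theorem sortBarOp_eq {n : ℕ} (i : Fin (n - 1)) :
    sortBarOp i = 1 + permOp (transp i) - sortOp i := by
  refine end_ext fun μ => ?_
  have hne : μ (lo i) ≠ μ (hi i) := fun h => (lo_lt_hi i).ne (μ.injective h)
  simp only [sortBarOp, sortOp, permOp, LinearMap.sub_apply, LinearMap.add_apply,
    Module.End.one_apply, linearize_single]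
  rcases lt_or_gt_of_ne hne with h | h
  · rw [if_pos h, if_neg (not_lt.mpr h.le)]; abel
  · rw [if_neg (not_lt.mpr (le_of_lt h)), if_pos h]; abel

theorem sortBarOp_mem {n : ℕ} (i : Fin (n - 1)) : op (sortBarOp i) ∈ HS n := by
  rw [sortBarOp_eq]
  exact sub_mem (add_mem (one_mem _) (permOp_transp_mem i)) (sortOp_mem i)

theorem permOp_mul {n : ℕ} (τ υ : Equiv.Perm (Fin n)) :
    op (permOp (τ * υ)) = op (permOp τ) * op (permOp υ) := by
  rw [← op_mul]
  congr 1
  refine end_ext fun μ => ?_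
  simp only [permOp, Module.End.mul_apply, linearize_single, mul_assoc]

theorem permOp_one {n : ℕ} : permOp (1 : Equiv.Perm (Fin n)) = 1 := by
  refine end_ext fun μ => ?_
  simp only [permOp, linearize_single, mul_one, Module.End.one_apply]

theorem permOp_mem {n : ℕ} (τ : Equiv.Perm (Fin n)) : op (permOp τ) ∈ HS n := by
  cases n with
  | zero =>
    rw [Subsingleton.elim τ 1, permOp_one]
    exact one_mem _
  | succ m =>
    have hτ : τ ∈ Submonoid.closure
        (Set.range fun i : Fin m => Equiv.swap i.castSucc i.succ) := by
      rw [Equiv.Perm.mclosure_swap_castSucc_succ]; trivial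
    induction hτ using Submonoid.closure_induction with
    | mem x hx => obtain ⟨i, rfl⟩ := hx; exact permOp_transp_mem (n := m + 1) i
    | one => rw [permOp_one]; exact one_mem _
    | mul x y _ _ hx hy => rw [permOp_mul]; exact mul_mem hx hy

/-- The permutation `τ` as an element of `H𝔖ₙ`; this is the embedding of `𝔖ₙ`, hence of `ℂ[𝔖ₙ]`,
into `H𝔖ₙ`. -/
noncomputable def HS.perm {n : ℕ} (τ : Equiv.Perm (Fin n)) : HS n := ⟨_, permOp_mem τ⟩

/-- The generator `σᵢ` of `H𝔖ₙ`. -/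
noncomputable def HS.σ {n : ℕ} (i : Fin (n - 1)) : HS n := HS.perm (transp i)

/-- The generator `πᵢ` of `H𝔖ₙ` (decreasing sort). -/
noncomputable def HS.π {n : ℕ} (i : Fin (n - 1)) : HS n := ⟨_, sortOp_mem i⟩

/-- The increasing sort operator as an element of `H𝔖ₙ`. -/
noncomputable def HS.πbar {n : ℕ} (i : Fin (n - 1)) : HS n := ⟨_, sortBarOp_mem i⟩

/-- The generator `Tᵢ = (q - 1) (1 - πᵢ) + q σᵢ` of the Hecke algebra inside `H𝔖ₙ`. -/
noncomputable def HS.T {n : ℕ} (q : ℂ) (i : Fin (n - 1)) : HS n :=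
  (q - 1) • (1 - HS.π i) + q • HS.σ i

/-- The Hecke algebra `Hₙ(q)`, realised inside `H𝔖ₙ`. -/
noncomputable def hecke (n : ℕ) (q : ℂ) : Subalgebra ℂ (HS n) :=
  Algebra.adjoin ℂ (Set.range (HS.T (n := n) q))

/-! ### The right `H𝔖ₙ`-modules `Pₙᵏ` -/

/-- The space of vectors of `ℂ𝔖ₙ` that are left `i`-antisymmetric for all `i ∈ A`.  For a composition
`I` of `n`, the module `P_I` is the case where `A` is the complement of the descent set of `I`. -/
noncomputable def antisym (n : ℕ) (A : Set (Fin (n - 1))) : Submodule ℂ (PermSpace n) :=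
  ⨅ i ∈ A, LinearMap.ker (1 + leftOp i)

theorem mem_antisym {n : ℕ} {A : Set (Fin (n - 1))} {v : PermSpace n} :
    v ∈ antisym n A ↔ ∀ i ∈ A, leftOp i v = -v := by
  simp only [antisym, Submodule.mem_iInf, LinearMap.mem_ker, LinearMap.add_apply,
    Module.End.one_apply]
  refine forall₂_congr fun i _ => ?_
  rw [add_comm, add_eq_zero_iff_eq_neg]

theorem transp_order {n : ℕ} (j : Fin (n - 1)) (a b : Fin n) (hab : a < b)
    (h : ¬ transp j a < transp j b) : a = lo j ∧ b = hi j := by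
  unfold transp at h
  simp only [Equiv.swap_apply_def] at h
  simp only [lo, hi, Fin.ext_iff, Fin.lt_def] at *
  split_ifs at h <;> simp_all <;> omega

theorem sort_left {n : ℕ} (i j : Fin (n - 1)) (v : PermSpace n) (hv : leftOp j v = -v) :
    leftOp j (sortOp i v) = -sortOp i v := by
  suffices h : ∀ w : PermSpace n,
      leftOp j (sortOp i (w - leftOp j w)) = -sortOp i (w - leftOp j w) by
    have h2 := h v
    rw [hv, sub_neg_eq_add] at h2
    simp only [map_add, neg_add] at h2
    have h3 : (2 : ℂ) • leftOp j (sortOp i v) = (2 : ℂ) • (-sortOp i v) := by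
      rw [two_smul, two_smul]; exact h2
    exact smul_right_injective _ two_ne_zero h3
  intro w
  suffices h : leftOp j ∘ₗ sortOp i ∘ₗ (1 - leftOp j) = -(sortOp i ∘ₗ (1 - leftOp j)) from
    LinearMap.congr_fun h w
  refine end_ext fun μ => ?_
  have hsq : transp j * (transp j * μ) = μ := by
    rw [← mul_assoc, transp, Equiv.swap_mul_self, one_mul]
  have hsq' : transp j * (transp j * (μ * transp i)) = μ * transp i := by
    rw [← mul_assoc, transp, Equiv.swap_mul_self, one_mul]
  simp only [sortOp, leftOp, LinearMap.comp_apply, LinearMap.sub_apply, LinearMap.neg_apply,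
    Module.End.one_apply, linearize_single, map_sub]
  by_cases hcase : ((transp j * μ) (hi i) < (transp j * μ) (lo i)) ↔ (μ (hi i) < μ (lo i))
  · by_cases h1 : μ (hi i) < μ (lo i)
    · rw [if_pos h1, if_pos (hcase.mpr h1), hsq]; abel
    · rw [if_neg h1, if_neg (fun h => h1 (hcase.mp h)), mul_assoc, hsq']; abel
  · have hne : μ (lo i) ≠ μ (hi i) := fun h => (lo_lt_hi i).ne (μ.injective h)
    have hconj : transp j * μ = μ * transp i := by
      have key : transp j = Equiv.swap (μ (lo i)) (μ (hi i)) := by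
        rcases lt_or_gt_of_ne hne with h | h
        · have := transp_order j _ _ h (fun h' => hcase
            (by simp only [Equiv.Perm.mul_apply]; exact iff_of_false h'.asymm h.asymm))
          rw [this.1, this.2]; rfl
        · have := transp_order j _ _ h (fun h' => hcase
            (by simp only [Equiv.Perm.mul_apply]; exact iff_of_true h' h))
          rw [this.1, this.2, Equiv.swap_comm]; rfl
      rw [key, transp, Equiv.mul_swap_eq_swap_mul]
    have hback : transp j * μ * transp i = μ := by
      rw [hconj, mul_assoc, transp, Equiv.swap_mul_self, mul_one]
    by_cases h1 : μ (hi i) < μ (lo i)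
    · have h2 : ¬ (transp j * μ) (hi i) < (transp j * μ) (lo i) := fun h => hcase (iff_of_true h h1)
      rw [if_pos h1, if_neg h2, hback]; simp
    · have h2 : (transp j * μ) (hi i) < (transp j * μ) (lo i) := by
        by_contra h; exact hcase (iff_of_false h h1)
      rw [if_neg h1, if_pos h2, ← hconj]; simp

theorem perm_left {n : ℕ} (τ : Equiv.Perm (Fin n)) (j : Fin (n - 1)) (v : PermSpace n) :
    leftOp j (permOp τ v) = permOp τ (leftOp j v) := by
  suffices h : leftOp j ∘ₗ permOp τ = permOp τ ∘ₗ leftOp j from LinearMap.congr_fun h v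
  refine end_ext fun μ => ?_
  simp only [permOp, leftOp, LinearMap.comp_apply, linearize_single, mul_assoc]

/-- `H𝔖ₙ` preserves left antisymmetries. -/
theorem HS_antisym {n : ℕ} (A : Set (Fin (n - 1))) (h : (Module.End ℂ (PermSpace n))ᵐᵒᵖ)
    (hh : h ∈ HS n) : ∀ v ∈ antisym n A, h.unop v ∈ antisym n A := by
  induction hh using Algebra.adjoin_induction with
  | mem x hx =>
    intro v hv
    rw [mem_antisym] at hv ⊢
    intro j hj
    rcases hx with ⟨i, rfl⟩ | ⟨i, rfl⟩
    · rw [unop_op, perm_left, hv j hj, map_neg]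
    · exact sort_left i j v (hv j hj)
  | algebraMap r => exact fun v hv => (antisym n A).smul_mem r hv
  | add x y _ _ hx hy => exact fun v hv => add_mem (hx v hv) (hy v hv)
  | mul x y _ _ hx hy => exact fun v hv => hy _ (hx v hv)

/-- For a subalgebra `A` of operators that preserve the subspaces `P` and `N` of `V`, the right
`A`-module `P / (P ∩ N)`. -/
noncomputable def subquotient {V : Type} [AddCommGroup V] [Module ℂ V]
    (A : Subalgebra ℂ (Module.End ℂ V)ᵐᵒᵖ) (P N : Submodule ℂ V)
    (hP : ∀ a ∈ A, ∀ v ∈ P, a.unop v ∈ P) (hN : ∀ a ∈ A, ∀ v ∈ N, a.unop v ∈ N) :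
    A →ₐ[ℂ] (Module.End ℂ (P ⧸ N.submoduleOf P))ᵐᵒᵖ where
  toFun a := op ((N.submoduleOf P).mapQ (N.submoduleOf P) (a.1.unop.restrict (hP a.1 a.2))
    (fun v hv => hN a.1 a.2 v.1 hv))
  map_one' := by
    apply unop_injective
    apply Submodule.linearMap_qext
    rfl
  map_mul' a b := by
    apply unop_injective
    apply Submodule.linearMap_qext
    rfl
  map_zero' := by
    apply unop_injective
    apply Submodule.linearMap_qext
    rfl
  map_add' a b := by
    apply unop_injective
    apply Submodule.linearMap_qext
    rfl
  commutes' r := by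
    apply unop_injective
    apply Submodule.linearMap_qext
    rfl

/-- The two mirror versions of the construction of `Pₙᵏ`: antisymmetrise over the first `k` values
and symmetrise over the others, or antisymmetrise over the last `k` values and symmetrise over the
others. -/
inductive Side : Type
  | first
  | last

/-- The complement of the descent set of `(k, 1, …, 1)`, resp. of `(1, …, 1, k)`. -/
def antiIdx (c : Side) (n k : ℕ) : Set (Fin (n - 1)) :=
  match c with
  | .first => {i | (i : ℕ) + 1 < k}
  | .last => {i | n ≤ (i : ℕ) + k}

/-- The indices `j` such that the values `j` and `j + 1` both lie outside of the block of `k`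
antisymmetrised values. -/
def symIdx (c : Side) (n k : ℕ) : Set (Fin (n - 1)) :=
  match c with
  | .first => {j | k ≤ (j : ℕ)}
  | .last => {j | (j : ℕ) + 1 + k < n}

/-- The module `P_{(k, 1, …, 1)}`, resp. `P_{(1, …, 1, k)}`. -/
noncomputable def topPart (c : Side) (n k : ℕ) : Submodule ℂ (PermSpace n) :=
  antisym n (antiIdx c n k)

/-- The sum of the modules `P_{(k, 1, …, 1, 2, 1, …, 1)}`, resp. `P_{(1, …, 1, 2, 1, …, 1, k)}`. -/
noncomputable def subPart (c : Side) (n k : ℕ) : Submodule ℂ (PermSpace n) :=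
  ⨆ j ∈ symIdx c n k, antisym n (insert j (antiIdx c n k))

theorem subPart_stable (c : Side) (n k : ℕ) (h : (Module.End ℂ (PermSpace n))ᵐᵒᵖ)
    (hh : h ∈ HS n) : ∀ v ∈ subPart c n k, h.unop v ∈ subPart c n k := by
  suffices hle : subPart c n k ≤ (subPart c n k).comap h.unop from hle
  refine iSup₂_le fun j hj v hv => ?_
  exact (le_iSup₂ (f := fun j (_ : j ∈ symIdx c n k) => antisym n (insert j (antiIdx c n k))) j hj)
    (HS_antisym _ h hh v hv)

/-- The space `Pₙᵏ`. -/
abbrev ExtQuot (c : Side) (n k : ℕ) : Type :=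
  topPart c n k ⧸ (subPart c n k).submoduleOf (topPart c n k)

/-- The right action of `H𝔖ₙ` on `Pₙᵏ`. -/
noncomputable def extQuotRep (c : Side) (n k : ℕ) :
    HS n →ₐ[ℂ] (Module.End ℂ (ExtQuot c n k))ᵐᵒᵖ :=
  subquotient (HS n) (topPart c n k) (subPart c n k) (HS_antisym _) (subPart_stable c n k)

/-- The direct sum of a family of right modules. -/
noncomputable def directSumRep {κ : Type} {A : Type} [Semiring A] [Algebra ℂ A] {V : κ → Type}
    [∀ k, AddCommMonoid (V k)] [∀ k, Module ℂ (V k)]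
    (ρ : ∀ k, A →ₐ[ℂ] (Module.End ℂ (V k))ᵐᵒᵖ) :
    A →ₐ[ℂ] (Module.End ℂ (⨁ k, V k))ᵐᵒᵖ where
  toFun a := op (DirectSum.lmap fun k => (ρ k a).unop)
  map_one' := by
    apply unop_injective
    refine LinearMap.ext fun x => DFinsupp.ext fun k => ?_
    simp [DirectSum.lmap_apply]
  map_mul' a b := by
    apply unop_injective
    refine LinearMap.ext fun x => DFinsupp.ext fun k => ?_
    simp [DirectSum.lmap_apply]
  map_zero' := by
    apply unop_injective
    refine LinearMap.ext fun x => DFinsupp.ext fun k => ?_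
    simp [DirectSum.lmap_apply]
  map_add' a b := by
    apply unop_injective
    refine LinearMap.ext fun x => DFinsupp.ext fun k => ?_
    simp [DirectSum.lmap_apply]
  commutes' r := by
    apply unop_injective
    refine LinearMap.ext fun x => DFinsupp.ext fun k => ?_
    simp [DirectSum.lmap_apply, MulOpposite.algebraMap_apply, Module.algebraMap_end_apply,
      DirectSum.smul_apply]

/-- The representation of `H𝔖ₙ` on exterior powers: the direct sum of the `Pₙᵏ` for
`1 ≤ k ≤ n`. -/
noncomputable def HSRep (c : Side) (n : ℕ) :
    HS n →ₐ[ℂ] (Module.End ℂ (⨁ k : Fin n, ExtQuot c n (k + 1)))ᵐᵒᵖ :=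
  directSumRep fun k : Fin n => extQuotRep c n (k + 1)

/-! ### Nondecreasing functions and exterior powers -/

/-- The monoid `NDFₙ` of nondecreasing functions; the product `f g` is `g ∘ f`. -/
abbrev NDF (n : ℕ) : Type := (Fin n →o Fin n)ᵐᵒᵖ

/-- The function `πᵢ`, sending `i + 1` to `i` and fixing all other points. -/
def piFun {n : ℕ} (i : Fin (n - 1)) : NDF n :=
  op
    { toFun := fun j => if j = hi i then lo i else j
      monotone' := by
        intro a b hab
        simp only [lo, hi, Fin.ext_iff, Fin.le_def] at *
        split_ifs <;> simp_all <;> omega }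

/-- The function sending `i` to `i + 1` and fixing all other points. -/
def piBarFun {n : ℕ} (i : Fin (n - 1)) : NDF n :=
  op
    { toFun := fun j => if j = lo i then hi i else j
      monotone' := by
        intro a b hab
        simp only [lo, hi, Fin.ext_iff, Fin.le_def] at *
        split_ifs <;> simp_all <;> omega }

/-- The monoid `NDPFₙ` of nondecreasing parking functions. -/
def NDPF (n : ℕ) : Submonoid (NDF n) where
  carrier := {f | ∀ i, f.unop i ≤ i}
  one_mem' := fun _ => le_rfl
  mul_mem' := fun {f _} hf hg i => (hg (f.unop i)).trans (hf i)

theorem piFun_mem {n : ℕ} (i : Fin (n - 1)) : piFun i ∈ NDPF n := by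
  intro j
  change (if j = hi i then lo i else j) ≤ j
  split_ifs with h
  · rw [h]; exact (lo_lt_hi i).le
  · exact le_rfl

/-- The generator `πᵢ` of `NDPFₙ`. -/
def NDPF.π {n : ℕ} (i : Fin (n - 1)) : NDPF n := ⟨piFun i, piFun_mem i⟩

/-- The right action of `NDFₙ` on the `k`-th exterior power of the natural representation:
`(x₁ ∧ ⋯ ∧ x_k) · f = (x₁ · f) ∧ ⋯ ∧ (x_k · f)` with `e_i · f = e_{f i}`. -/
noncomputable def extAction (n k : ℕ) : NDF n →* (Module.End ℂ (⋀[ℂ]^k (Fin n → ℂ)))ᵐᵒᵖ where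
  toFun f := op (exteriorPower.map k (linearize f.unop))
  map_one' := by
    change op (exteriorPower.map k (linearize id)) = 1
    rw [linearize_id, exteriorPower.map_id]; rfl
  map_mul' f g := by
    change op (exteriorPower.map k (linearize (g.unop ∘ f.unop))) = _
    rw [linearize_comp, ← op_mul, Module.End.mul_eq_comp, exteriorPower.map_comp]

/-- The right action of `ℂ[NDFₙ]` on the `k`-th exterior power. -/
noncomputable def extRep (n k : ℕ) :
    MonoidAlgebra ℂ (NDF n) →ₐ[ℂ] (Module.End ℂ (⋀[ℂ]^k (Fin n → ℂ)))ᵐᵒᵖ :=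
  MonoidAlgebra.lift ℂ _ (NDF n) (extAction n k)

/-- The representation of `ℂ[NDFₙ]` on exterior powers: the direct sum of the exterior powers for
`1 ≤ k ≤ n`. -/
noncomputable def NDFRep (n : ℕ) :
    MonoidAlgebra ℂ (NDF n) →ₐ[ℂ]
      (Module.End ℂ (⨁ k : Fin n, ⋀[ℂ]^((k : ℕ) + 1) (Fin n → ℂ)))ᵐᵒᵖ :=
  directSumRep fun k : Fin n => extRep n (k + 1)

/-- The element of `ℂ[NDFₙ]` corresponding to a function. -/
noncomputable abbrev ofNDF {n : ℕ} (f : NDF n) : MonoidAlgebra ℂ (NDF n) :=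
  MonoidAlgebra.of ℂ (NDF n) f

/-! ### The Temperley-Lieb algebra -/

/-- The defining relations of the Temperley-Lieb algebra on `n` strands with loop parameter `δ`. -/
inductive TLRel (n : ℕ) (δ : ℂ) :
    FreeAlgebra ℂ (Fin (n - 1)) → FreeAlgebra ℂ (Fin (n - 1)) → Prop
  | sq (i : Fin (n - 1)) :
      TLRel n δ (FreeAlgebra.ι ℂ i * FreeAlgebra.ι ℂ i) (δ • FreeAlgebra.ι ℂ i)
  | adj (i j : Fin (n - 1)) (h : (i : ℕ) + 1 = j ∨ (j : ℕ) + 1 = i) :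
      TLRel n δ (FreeAlgebra.ι ℂ i * FreeAlgebra.ι ℂ j * FreeAlgebra.ι ℂ i) (FreeAlgebra.ι ℂ i)
  | comm (i j : Fin (n - 1)) (h : (i : ℕ) + 1 < j) :
      TLRel n δ (FreeAlgebra.ι ℂ i * FreeAlgebra.ι ℂ j) (FreeAlgebra.ι ℂ j * FreeAlgebra.ι ℂ i)

/-- The Temperley-Lieb algebra on `n` strands with loop parameter `δ`. -/
abbrev TemperleyLieb (n : ℕ) (δ : ℂ) : Type := RingQuot (TLRel n δ)

/-- The generators of the Temperley-Lieb algebra. -/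
noncomputable def TemperleyLieb.e {n : ℕ} (δ : ℂ) (i : Fin (n - 1)) : TemperleyLieb n δ :=
  RingQuot.mkAlgHom ℂ (TLRel n δ) (FreeAlgebra.ι ℂ i)

/-! ### How the two mirror versions match `NDFₙ` -/

/-- The function by which the decreasing sort `πᵢ` of `H𝔖ₙ` acts. -/
def Side.sortFun (c : Side) {n : ℕ} (i : Fin (n - 1)) : NDF n :=
  match c with
  | .first => piBarFun i
  | .last => piFun i

/-- The function by which the increasing sort of `H𝔖ₙ` acts. -/
def Side.sortBarFun (c : Side) {n : ℕ} (i : Fin (n - 1)) : NDF n :=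
  match c with
  | .first => piFun i
  | .last => piBarFun i

/-- The relabelling of the generators: `i ↦ n - i`, resp. `i ↦ i`. -/
def Side.idx (c : Side) {n : ℕ} (i : Fin (n - 1)) : Fin (n - 1) :=
  match c with
  | .first => i.rev
  | .last => i

end HeckeSym

open MulOpposite
open scoped DirectSum

namespace HeckeSym

/-! ### Faithfulness of the exterior powers -/

/-! Each `Pₙᵏ` is the exterior power `⋀ᵏ ℂⁿ`: send a permutation to the wedge of the positions of
the `k` values in the block. Exchanging two block values changes the sign and exchanging two other
values changes nothing, so the submodules divided out go to `0`. The map is onto by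
antisymmetrisation. Up to scalars the class of an antisymmetrised permutation depends only on the
set of positions of its block values, so the quotient has dimension at most `n.choose k` and the map
is bijective (`extQuotToWedge_bijective`).

Sorting two positions acts on the wedge by an elementary nondecreasing function (`toWedge_sort`). If
just one of the two values is in the block, sorting puts it on a fixed side, because the block
consists of the smallest or of the largest values. If both are, `μ` and `μ * swap p q` have opposite
coefficients and the same sorted form, so they cancel, as they do for the function because two
factors become equal.

The algebra of `NDFₙ` acts faithfully on the exterior powers by a triangularity argument
(`exists_section`, `eq_zero_of_extRep`). Hence the action of `H𝔖ₙ` factors through a unique `Φ`. It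
is onto since the elementary functions generate `NDFₙ`, and its kernel is that of `ρ`, as `ρ` is `Φ`
followed by a faithful representation `K`.

It remains to identify images under `Φ`. `Hₙ(0)` is generated by the `πᵢ`, whose images generate
`NDPFₙ` or its mirror image. In `Hₙ(-1)` one has `1 + Tᵢ = πᵢ - π̄ᵢ`, which maps to `±(pᵢ - p̄ᵢ)`;
multiplied by `√-1` these satisfy the Temperley-Lieb relations. Injectivity comes from Jones normal
words: they span (`normal_mul`), and their images have pairwise distinct pointwise smallest terms,
obtained by replacing every generator by `pᵢ` (`wordVal_runs_sub_mem`, `lowerWord_runs_injective`).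
-/

theorem directSumRep_eq_iff {κ : Type} [DecidableEq κ] {A : Type} [Semiring A] [Algebra ℂ A]
    {V : κ → Type} [∀ k, AddCommMonoid (V k)] [∀ k, Module ℂ (V k)]
    (ρ : ∀ k, A →ₐ[ℂ] (Module.End ℂ (V k))ᵐᵒᵖ) {a b : A} :
    directSumRep ρ a = directSumRep ρ b ↔ ∀ k, ρ k a = ρ k b := by
  constructor
  · intro h k
    apply unop_injective
    refine LinearMap.ext fun x => ?_
    have h2 := congrArg (fun T => (unop T) (DirectSum.lof ℂ κ V k x) k) h
    simpa [directSumRep, DirectSum.lmap_apply] using h2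
  · intro h
    apply unop_injective
    refine LinearMap.ext fun x => DFinsupp.ext fun k => ?_
    simp [directSumRep, DirectSum.lmap_apply, h]

/-- The wedge product of the basis vectors indexed by `s`. -/
noncomputable def wedge {n k : ℕ} (s : Fin k → Fin n) : ⋀[ℂ]^k (Fin n → ℂ) :=
  exteriorPower.ιMulti ℂ k fun j => (Pi.single (s j) 1 : Fin n → ℂ)

theorem map_wedge {n k : ℕ} (f : Fin n → Fin n) (s : Fin k → Fin n) :
    exteriorPower.map k (linearize f) (wedge s) = wedge (f ∘ s) := by
  rw [wedge, exteriorPower.map_apply_ιMulti]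
  congr 1
  funext j
  exact linearize_single f (s j)

theorem wedge_eq_zero {n k : ℕ} {s : Fin k → Fin n} {i j : Fin k} (h : s i = s j)
    (hij : i ≠ j) : wedge s = 0 :=
  (exteriorPower.ιMulti ℂ k).map_eq_zero_of_eq _ (by simp [h]) hij

theorem wedge_perm {n k : ℕ} (s : Fin k → Fin n) (σ : Equiv.Perm (Fin k)) :
    wedge (s ∘ σ) = Equiv.Perm.sign σ • wedge s :=
  (exteriorPower.ιMulti ℂ k).map_perm (fun j => (Pi.single (s j) 1 : Fin n → ℂ)) σ

theorem span_wedge (n k : ℕ) :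
    Submodule.span ℂ (Set.range fun s : Fin k → Fin n => wedge s) = ⊤ := by
  rw [eq_top_iff, ← exteriorPower.ιMulti_span_of_span ℂ k (Fin n → ℂ)
    (s := Set.range fun x : Fin n => (Pi.single x 1 : Fin n → ℂ))]
  · refine Submodule.span_mono ?_
    rintro _ ⟨v, hv, rfl⟩
    choose s hs using fun j => hv (Set.mem_range_self j)
    exact ⟨s, congrArg (exteriorPower.ιMulti ℂ k) (funext hs)⟩
  · have := (Pi.basisFun ℂ (Fin n)).span_eq
    rwa [show ⇑(Pi.basisFun ℂ (Fin n)) = fun x => Pi.single x 1 from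
      funext fun x => Pi.basisFun_apply ℂ _ x] at this

/-- The coefficient of `wedge t`. -/
noncomputable def wedgeCoord {n k : ℕ} (t : Fin k → Fin n) :
    Module.Dual ℂ (⋀[ℂ]^k (Fin n → ℂ)) :=
  exteriorPower.pairingDual ℂ (Fin n → ℂ) k
    (exteriorPower.ιMulti ℂ k fun j => LinearMap.proj (t j))

theorem wedgeCoord_wedge {n k : ℕ} (t s : Fin k → Fin n) :
    wedgeCoord t (wedge s) = (Matrix.of fun i j => if s i = t j then (1 : ℂ) else 0).det := by
  rw [wedgeCoord, wedge, exteriorPower.pairingDual_ιMulti_ιMulti]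
  congr 1
  ext i j
  simp [Pi.single_apply, eq_comm]

theorem wedgeCoord_self {n k : ℕ} {t : Fin k → Fin n} (ht : Function.Injective t) :
    wedgeCoord t (wedge t) = 1 := by
  rw [wedgeCoord_wedge, ← Matrix.det_one (n := Fin k)]
  congr 1
  ext i j
  simp [Matrix.one_apply, ht.eq_iff]

/-- A nonzero determinant has no zero column, so every value of `t` is a value of `s`. As `t` is
injective, `s` must be a rearrangement of `t`, and both are increasing. -/
theorem wedgeCoord_ne_zero {n k : ℕ} {t s : Fin k → Fin n} (ht : StrictMono t) (hs : Monotone s)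
    (h : wedgeCoord t (wedge s) ≠ 0) : s = t := by
  rw [wedgeCoord_wedge] at h
  have hcol : ∀ j, ∃ i, s i = t j := by
    intro j
    by_contra! hj
    exact h (Matrix.det_eq_zero_of_column_eq_zero j fun i => by simp [hj i])
  choose τ hτ using hcol
  have hinj : Function.Injective τ := fun a b hab => ht.injective (by rw [← hτ a, ← hτ b, hab])
  have hsur : Function.Surjective τ := Finite.surjective_of_injective hinj
  have hsinj : Function.Injective s := by
    intro a b hab
    obtain ⟨a, rfl⟩ := hsur a
    obtain ⟨b, rfl⟩ := hsur b
    rw [hτ, hτ] at hab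
    rw [ht.injective hab]
  refine (StrictMono.range_inj (hs.strictMono_of_injective hsinj) ht).mp ?_
  ext x
  constructor
  · rintro ⟨a, rfl⟩
    obtain ⟨a, rfl⟩ := hsur a
    exact ⟨a, (hτ a).symm⟩
  · rintro ⟨a, rfl⟩
    exact ⟨τ a, hτ a⟩

theorem extRep_apply_wedge {n k : ℕ} (a : MonoidAlgebra ℂ (NDF n)) (s : Fin k → Fin n) :
    (extRep n k a).unop (wedge s) = a.coeff.sum fun f c => c • wedge (f.unop ∘ s) := by
  rw [extRep, MonoidAlgebra.lift_apply, Finsupp.sum, Finset.unop_sum, LinearMap.sum_apply]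
  refine Finset.sum_congr rfl fun f _ => ?_
  rw [unop_smul, LinearMap.smul_apply]
  congr 1
  exact map_wedge _ _

/-- A set on which `f` is injective, and such that every nondecreasing function which agrees with
`f` on this set is at most `f`. -/
theorem exists_section {n : ℕ} (hn : 1 ≤ n) (f : Fin n →o Fin n) :
    ∃ (k : Fin n) (s : Fin (k + 1) → Fin n), StrictMono s ∧ StrictMono (f ∘ s) ∧
      ∀ g : Fin n →o Fin n, g ∘ s = f ∘ s → g ≤ f := by
  classical
  -- The largest element of each fibre of `f`. If `m` is the one above `x`, then `g x ≤ g m = f m =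
  -- f x` for every `g` that agrees with `f` on `S`.
  let S : Finset (Fin n) := Finset.univ.filter fun x => ∀ y, f y = f x → y ≤ x
  have hmax : ∀ x, ∃ m ∈ S, x ≤ m ∧ f m = f x := by
    intro x
    obtain ⟨m, hm, hm2⟩ := (Finset.univ.filter fun y => f y = f x).exists_max_image id ⟨x, by simp⟩
    simp only [Finset.mem_filter, Finset.mem_univ, true_and, id] at hm hm2
    refine ⟨m, ?_, hm2 x rfl, hm⟩
    simp only [S, Finset.mem_filter, Finset.mem_univ, true_and]
    intro y hy
    exact hm2 y (hy.trans hm)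
  have hpos : 0 < S.card := by
    obtain ⟨m, hm, -⟩ := hmax ⟨0, hn⟩
    exact Finset.card_pos.mpr ⟨m, hm⟩
  have hle : S.card ≤ n := by simpa using S.card_le_univ
  -- The index `k : Fin n` stands for the degree `k + 1`, hence the shift by one and the need for
  -- `S` to be nonempty.
  have hk : S.card = (⟨S.card - 1, by omega⟩ : Fin n).1 + 1 := by simp only; omega
  refine ⟨⟨S.card - 1, by omega⟩, S.orderEmbOfFin hk, (S.orderEmbOfFin hk).strictMono, ?_, ?_⟩
  · refine (f.monotone.comp (S.orderEmbOfFin hk).monotone).strictMono_of_injective ?_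
    intro a b hab
    have ha := S.orderEmbOfFin_mem hk a
    have hb := S.orderEmbOfFin_mem hk b
    simp only [S, Finset.mem_filter, Finset.mem_univ, true_and] at ha hb
    exact (S.orderEmbOfFin hk).injective (le_antisymm (hb _ hab) (ha _ hab.symm))
  · intro g hg x
    obtain ⟨m, hm, hxm, hfm⟩ := hmax x
    rw [← Finset.mem_coe, ← S.range_orderEmbOfFin hk] at hm
    obtain ⟨i, rfl⟩ := hm
    calc g x ≤ g (S.orderEmbOfFin hk i) := g.monotone hxm
      _ = f (S.orderEmbOfFin hk i) := congrFun hg i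
      _ = f x := hfm

/-- Take `f` pointwise minimal in the support of `a`, with `s` from `exists_section`, and read the
coefficient of `wedge (f ∘ s)` in the image of `wedge s`. A function `g` contributes only if `g ∘ s
= f ∘ s`, which forces `g ≤ f`, hence `g = f`. -/
theorem eq_zero_of_extRep {n : ℕ} (hn : 1 ≤ n) (a : MonoidAlgebra ℂ (NDF n))
    (h : ∀ k : Fin n, extRep n (k + 1) a = 0) : a = 0 := by
  by_contra ha
  have hsupp : (a.coeff.support.image unop).Nonempty := by
    rw [Finset.image_nonempty, Finsupp.support_nonempty_iff]
    simpa using ha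
  obtain ⟨f, hf⟩ := (a.coeff.support.image unop).exists_minimal hsupp
  obtain ⟨k, s, hs, hfs, hmin⟩ := exists_section hn f
  have h0 := congrArg (fun T => wedgeCoord (f ∘ s) ((unop T) (wedge s))) (h k)
  simp only [extRep_apply_wedge, unop_zero, LinearMap.zero_apply, map_zero, Finsupp.sum,
    map_sum, map_smul] at h0
  obtain ⟨f', hf', rfl⟩ := Finset.mem_image.mp hf.1
  rw [Finset.sum_eq_single f'] at h0
  · rw [wedgeCoord_self hfs.injective, smul_eq_mul, mul_one] at h0
    exact Finsupp.mem_support_iff.mp hf' h0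
  · intro g hg hne
    rw [smul_eq_zero]
    right
    by_contra h1
    have hle := hmin g.unop
      (wedgeCoord_ne_zero hfs (g.unop.monotone.comp hs.monotone) h1)
    exact hne (unop_injective (le_antisymm hle (hf.2 (Finset.mem_image_of_mem _ hg) hle)))
  · exact fun h => absurd hf' h

theorem NDFRep_injective {n : ℕ} (hn : 1 ≤ n) : Function.Injective (NDFRep n) := by
  rw [injective_iff_map_eq_zero]
  intro a ha
  refine eq_zero_of_extRep hn a fun k => ?_
  rw [← map_zero (NDFRep n)] at ha
  simpa using (directSumRep_eq_iff _).mp ha k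

/-! ### Generators of the monoids of nondecreasing functions -/

@[simp] theorem piFun_apply {n : ℕ} (i : Fin (n - 1)) (x : Fin n) :
    (piFun i).unop x = if x = hi i then lo i else x := rfl

@[simp] theorem piBarFun_apply {n : ℕ} (i : Fin (n - 1)) (x : Fin n) :
    (piBarFun i).unop x = if x = lo i then hi i else x := rfl

theorem NDF_ext {n : ℕ} {f g : NDF n} (h : ∀ x, f.unop x = g.unop x) : f = g :=
  unop_injective (OrderHom.ext _ _ (funext h))

theorem NDF_mul_apply {n : ℕ} (f g : NDF n) (x : Fin n) : (f * g).unop x = g.unop (f.unop x) :=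
  rfl

/-- Let `x` be the largest point moved by `f` and raise the value there by one. The result `g` is
still nondecreasing because `f` fixes everything above `x` and `f x + 1 ≤ x`. Applying `p_i` with `i
= f x` undoes the change and touches no other value. -/
theorem NDPF_exists_mul_piFun {n : ℕ} {f : NDF n} (hf : f ∈ NDPF n) (h1 : f ≠ 1) :
    ∃ g ∈ NDPF n, ∃ i, f = g * piFun i ∧ ∑ x, (f.unop x : ℕ) < ∑ x, (g.unop x : ℕ) := by
  classical
  have hne : (Finset.univ.filter fun x => f.unop x ≠ x).Nonempty := by
    by_contra h
    rw [Finset.not_nonempty_iff_eq_empty, Finset.filter_eq_empty_iff] at h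
    exact h1 (NDF_ext fun x => by simpa using h (Finset.mem_univ x))
  obtain ⟨x, hx, hmax⟩ := (Finset.univ.filter fun x => f.unop x ≠ x).exists_max_image id hne
  simp only [Finset.mem_filter, Finset.mem_univ, true_and, id] at hx hmax
  have hlt : f.unop x < x := lt_of_le_of_ne (hf x) hx
  have hfix : ∀ y, x < y → f.unop y = y := by
    intro y hy
    by_contra h
    exact absurd (hmax y h) (not_le.mpr hy)
  have hlt' : (f.unop x : ℕ) < x := hlt
  have hxn := x.isLt
  let i : Fin (n - 1) := ⟨f.unop x, by omega⟩
  have hlo : lo i = f.unop x := rfl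
  have hhi : hi i ≤ x := by simp only [hi, Fin.le_def, i]; omega
  have hlh := lo_lt_hi i
  let g : NDF n := op
    { toFun := Function.update f.unop x (hi i)
      monotone' := by
        intro a b hab
        rcases eq_or_ne a x with ha | ha <;> rcases eq_or_ne b x with hb | hb
        · rw [ha, hb]
        · rw [ha, Function.update_self, Function.update_of_ne hb,
            hfix b (lt_of_le_of_ne (ha ▸ hab) hb.symm)]
          exact hhi.trans (ha ▸ hab)
        · rw [hb] at hab ⊢
          rw [Function.update_self, Function.update_of_ne ha]
          exact (f.unop.monotone hab).trans (hlo ▸ hlh.le)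
        · rw [Function.update_of_ne ha, Function.update_of_ne hb]
          exact f.unop.monotone hab }
  have hgx : g.unop x = hi i := Function.update_self ..
  have hgy : ∀ y, y ≠ x → g.unop y = f.unop y := fun y hy => Function.update_of_ne hy ..
  refine ⟨g, ?_, i, ?_, ?_⟩
  · intro y
    rcases eq_or_ne y x with rfl | hy
    · rw [hgx]; exact hhi
    · rw [hgy y hy]; exact hf y
  · refine NDF_ext fun y => ?_
    rw [NDF_mul_apply, piFun_apply]
    rcases lt_trichotomy y x with hy | rfl | hy
    · rw [hgy y hy.ne, if_neg]
      have := f.unop.monotone hy.le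
      exact (this.trans_lt (hlo ▸ hlh)).ne
    · rw [hgx, if_pos rfl, hlo]
    · rw [hgy y hy.ne', hfix y hy, if_neg (hhi.trans_lt hy).ne']
  · refine Finset.sum_lt_sum (fun y _ => ?_) ⟨x, Finset.mem_univ x, ?_⟩
    · rcases eq_or_ne y x with rfl | hy
      · rw [hgx]; exact (hlo ▸ hlh).le
      · rw [hgy y hy]
    · rw [hgx]; exact hlo ▸ hlh

theorem NDPF_eq_closure (n : ℕ) : NDPF n = Submonoid.closure (Set.range piFun) := by
  refine le_antisymm ?_ (Submonoid.closure_le.mpr ?_)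
  -- The sum of the values grows when a generator is split off and is at most `n * n`, so the
  -- difference is a terminating measure.
  · suffices h : ∀ d : ℕ, ∀ f ∈ NDPF n, n * n - ∑ x, (f.unop x : ℕ) = d →
        f ∈ Submonoid.closure (Set.range piFun) from fun f hf => h _ f hf rfl
    intro d
    induction d using Nat.strong_induction_on with
    | _ d ih =>
      intro f hf hd
      rcases eq_or_ne f 1 with rfl | h1
      · exact one_mem _
      obtain ⟨g, hg, i, rfl, hlt⟩ := NDPF_exists_mul_piFun hf h1
      have hle : ∑ x, (g.unop x : ℕ) ≤ n * n := by
        calc ∑ x, (g.unop x : ℕ) ≤ ∑ _x : Fin n, n := Finset.sum_le_sum fun x _ => (g.unop x).2.le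
          _ = n * n := by simp
      exact mul_mem (ih _ (by omega) g hg rfl) (Submonoid.subset_closure ⟨i, rfl⟩)
  · rintro _ ⟨i, rfl⟩
    exact piFun_mem i

/-- Conjugation by the order reversing bijection. -/
def revConj (n : ℕ) : NDF n ≃* NDF n where
  toFun f := op ⟨fun x => (f.unop x.rev).rev, fun _ _ h =>
    Fin.rev_le_rev.mpr (f.unop.monotone (Fin.rev_le_rev.mpr h))⟩
  invFun f := op ⟨fun x => (f.unop x.rev).rev, fun _ _ h =>
    Fin.rev_le_rev.mpr (f.unop.monotone (Fin.rev_le_rev.mpr h))⟩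
  left_inv f := NDF_ext fun x => by
    change (f.unop x.rev.rev).rev.rev = _
    rw [Fin.rev_rev, Fin.rev_rev]
  right_inv f := NDF_ext fun x => by
    change (f.unop x.rev.rev).rev.rev = _
    rw [Fin.rev_rev, Fin.rev_rev]
  map_mul' f g := NDF_ext fun x => by
    change _ = (g.unop (f.unop x.rev).rev.rev).rev
    rw [Fin.rev_rev]
    rfl

theorem revConj_apply {n : ℕ} (f : NDF n) (x : Fin n) :
    (revConj n f).unop x = (f.unop x.rev).rev := rfl

theorem rev_lo {n : ℕ} (i : Fin (n - 1)) : (lo i).rev = hi i.rev := by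
  simp only [lo, hi, Fin.ext_iff, Fin.val_rev]; omega

theorem rev_hi {n : ℕ} (i : Fin (n - 1)) : (hi i).rev = lo i.rev := by
  simp only [lo, hi, Fin.ext_iff, Fin.val_rev]; omega

theorem revConj_piFun {n : ℕ} (i : Fin (n - 1)) : revConj n (piFun i) = piBarFun i.rev := by
  refine NDF_ext fun x => ?_
  rw [revConj_apply, piFun_apply, piBarFun_apply, apply_ite Fin.rev, Fin.rev_rev, rev_lo]
  refine if_congr ?_ rfl rfl
  rw [Fin.rev_eq_iff, rev_hi]

/-- Every `f` is a decreasing part `d` followed by an increasing part `u`. Where `f x ≤ x`, `d`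
already reaches `f x`, and `u` fixes it because `f (f x) ≤ f x`. The part `u` becomes a parking
function after order reversal. -/
theorem closure_piFun_piBarFun (n : ℕ) :
    Submonoid.closure (Set.range piFun ∪ Set.range piBarFun : Set (NDF n)) = ⊤ := by
  rw [eq_top_iff]
  rintro f -
  let d : NDF n := op ⟨fun x => min x (f.unop x), fun a b h => min_le_min h (f.unop.monotone h)⟩
  let u : NDF n := op ⟨fun x => max x (f.unop x), fun a b h => max_le_max h (f.unop.monotone h)⟩
  have hf : f = d * u := by
    refine NDF_ext fun x => ?_
    change f.unop x = max (min x (f.unop x)) (f.unop (min x (f.unop x)))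
    rcases le_total x (f.unop x) with h | h
    · rw [min_eq_left h, max_eq_right h]
    · rw [min_eq_right h, max_eq_left (f.unop.monotone h)]
  have hd : d ∈ NDPF n := fun x => min_le_left _ _
  have hu : revConj n u ∈ NDPF n := by
    intro x
    rw [revConj_apply, Fin.rev_le_iff]
    exact le_max_left _ _
  rw [NDPF_eq_closure] at hd hu
  rw [hf]
  refine mul_mem (Submonoid.closure_mono Set.subset_union_left hd) ?_
  have h := Submonoid.mem_map_of_mem (revConj n).toMonoidHom hu
  rw [MonoidHom.map_mclosure] at h
  have huu : (revConj n).toMonoidHom (revConj n u) = u := (revConj n).left_inv u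
  rw [huu] at h
  refine Submonoid.closure_mono ?_ h
  rintro _ ⟨_, ⟨i, rfl⟩, rfl⟩
  exact Or.inr ⟨i.rev, (revConj_piFun i).symm⟩

/-! ### Parabolic subgroups -/

/-- The indices `i` such that `i` and `i + 1` both lie in `B`. -/
def inner {n : ℕ} (B : Set (Fin n)) : Set (Fin (n - 1)) := {i | lo i ∈ B ∧ hi i ∈ B}

/-- The group generated by the elementary transpositions that exchange two elements of `B`. -/
def parabolic {n : ℕ} (B : Set (Fin n)) : Subgroup (Equiv.Perm (Fin n)) :=
  Subgroup.closure (transp '' inner B)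

/-- Induction on the distance: with `r` just below `q`, the transposition of `p` and `q` is the
conjugate of `swap p r` by the elementary transposition `swap r q`. Convexity of `B` keeps `r`
inside. -/
theorem swap_mem_parabolic_of_lt {n : ℕ} {B : Set (Fin n)} (hB : B.OrdConnected) (d : ℕ) :
    ∀ p q : Fin n, p ∈ B → q ∈ B → (q : ℕ) = p + d + 1 → Equiv.swap p q ∈ parabolic B := by
  induction d with
  | zero =>
    intro p q hp hq h
    have hqn := q.isLt
    refine Subgroup.subset_closure ⟨⟨p, by omega⟩, ⟨hp, ?_⟩, ?_⟩
    · convert hq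
      exact Fin.ext (by simp only [hi]; omega)
    · rw [transp]
      congr 1
      exact Fin.ext (by simp only [hi]; omega)
  | succ d ih =>
    intro p q hp hq h
    have hqn := q.isLt
    let r : Fin n := ⟨p + d + 1, by omega⟩
    have hr : r ∈ B := hB.out hp hq
      ⟨by simp only [Fin.le_def, r]; omega, by simp only [Fin.le_def, r]; omega⟩
    have h1 : Equiv.swap p r ∈ parabolic B := ih p r hp hr rfl
    have h2 : Equiv.swap q r ∈ parabolic B := by
      rw [Equiv.swap_comm]
      refine Subgroup.subset_closure ⟨⟨r, by simp only [r]; omega⟩, ⟨hr, ?_⟩, ?_⟩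
      · convert hq
        exact Fin.ext (by simp only [hi, r]; omega)
      · rw [transp]
        congr 1
        exact Fin.ext (by simp only [hi, r]; omega)
    have hrq : r ≠ q := Fin.ne_of_val_ne (by simp only [r]; omega)
    have hpq : p ≠ q := Fin.ne_of_val_ne (by omega)
    rw [Equiv.swap_comm p q, ← Equiv.swap_mul_swap_mul_swap (x := p) (y := r) (z := q)]
    · rw [Equiv.swap_comm r q]
      exact mul_mem (mul_mem h2 h1) h2
    · exact Fin.ne_of_val_ne (by simp only [r]; omega)
    · exact hpq

theorem swap_mem_parabolic {n : ℕ} {B : Set (Fin n)} (hB : B.OrdConnected) {p q : Fin n}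
    (hp : p ∈ B) (hq : q ∈ B) : Equiv.swap p q ∈ parabolic B := by
  rcases lt_trichotomy p q with h | rfl | h
  · have h' : (p : ℕ) < q := h
    exact swap_mem_parabolic_of_lt hB (q - p - 1) p q hp hq (by omega)
  · rw [Equiv.swap_self]; exact one_mem _
  · have h' : (q : ℕ) < p := h
    rw [Equiv.swap_comm]
    exact swap_mem_parabolic_of_lt hB (p - q - 1) q p hq hp (by omega)

theorem mem_parabolic {n : ℕ} {B : Set (Fin n)} (hB : B.OrdConnected) {σ : Equiv.Perm (Fin n)}
    (h : ∀ x ∉ B, σ x = x) : σ ∈ parabolic B := by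
  classical
  have hpres : ∀ x, σ x ∈ B ↔ x ∈ B := by
    intro x
    by_cases hx : x ∈ B
    · refine iff_of_true ?_ hx
      by_contra h1
      have h2 := σ.injective (h _ h1)
      rw [h2] at h1
      exact h1 hx
    · rw [h x hx]
  have hσ : σ = Equiv.Perm.ofSubtype (σ.subtypePerm hpres) :=
    (Equiv.Perm.ofSubtype_subtypePerm hpres fun x hx => by
      by_contra h1; exact hx (h x h1)).symm
  rw [hσ]
  induction σ.subtypePerm hpres using Equiv.Perm.swap_induction_on with
  | one => rw [map_one]; exact one_mem _
  | swap_mul f x y _ hf =>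
    rw [map_mul, Equiv.Perm.ofSubtype_swap_eq]
    exact mul_mem (swap_mem_parabolic hB x.2 y.2) hf

/-- The factor `u` agrees with `σ` on `B` and is the identity outside; then `u⁻¹ * σ` fixes `B`
pointwise. -/
theorem exists_parabolic_mul {n : ℕ} {B : Set (Fin n)} (hB : B.OrdConnected)
    (hB' : Bᶜ.OrdConnected) {σ : Equiv.Perm (Fin n)} (h : ∀ x, σ x ∈ B ↔ x ∈ B) :
    ∃ u ∈ parabolic B, ∃ w ∈ parabolic Bᶜ, σ = u * w := by
  classical
  let u : Equiv.Perm (Fin n) := Equiv.Perm.ofSubtype (σ.subtypePerm h)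
  have hu : ∀ x ∈ B, u x = σ x := fun x hx => Equiv.Perm.ofSubtype_apply_of_mem _ hx
  have hu' : ∀ x ∉ B, u x = x := fun x hx => Equiv.Perm.ofSubtype_apply_of_not_mem _ hx
  refine ⟨u, mem_parabolic hB hu', u⁻¹ * σ, mem_parabolic hB' ?_, by group⟩
  intro x hx
  rw [Set.notMem_compl_iff] at hx
  rw [Equiv.Perm.mul_apply, ← hu x hx]
  exact u.symm_apply_apply x

theorem parabolic_commute {n : ℕ} {B : Set (Fin n)} {u w : Equiv.Perm (Fin n)}
    (hu : u ∈ parabolic B) (hw : w ∈ parabolic Bᶜ) : Commute u w := by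
  have hfix : ∀ (C : Set (Fin n)) (v : Equiv.Perm (Fin n)), v ∈ parabolic C →
      ∀ x ∉ C, v x = x := by
    intro C v hv
    induction hv using Subgroup.closure_induction with
    | mem v hv =>
      obtain ⟨i, hi, rfl⟩ := hv
      intro x hx
      exact Equiv.swap_apply_of_ne_of_ne (fun h => hx (h ▸ hi.1)) (fun h => hx (h ▸ hi.2))
    | one => exact fun x _ => rfl
    | mul v w _ _ hv hw => exact fun x hx => by rw [Equiv.Perm.mul_apply, hw x hx, hv x hx]
    | inv v _ hv => exact fun x hx => by rw [Equiv.Perm.inv_eq_iff_eq, hv x hx]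
  refine Equiv.Perm.Disjoint.commute fun x => ?_
  by_cases hx : x ∈ B
  · exact Or.inr (hfix _ w hw x (by simpa using hx))
  · exact Or.inl (hfix _ u hu x hx)

/-- The sign of a permutation as a complex number. -/
noncomputable def csign {n : ℕ} : Equiv.Perm (Fin n) →* ℂ :=
  ((Int.castRingHom ℂ : ℤ →* ℂ).comp (Units.coeHom ℤ)).comp Equiv.Perm.sign

theorem csign_mul_self {n : ℕ} (w : Equiv.Perm (Fin n)) : csign w * csign w = 1 := by
  rw [← map_mul]
  change (((Equiv.Perm.sign (w * w) : ℤˣ) : ℤ) : ℂ) = 1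
  rw [map_mul, Int.units_mul_self, Units.val_one, Int.cast_one]

theorem csign_swap {n : ℕ} {p q : Fin n} (h : p ≠ q) : csign (Equiv.swap p q) = -1 := by
  change (((Equiv.Perm.sign (Equiv.swap p q) : ℤˣ) : ℤ) : ℂ) = -1
  rw [Equiv.Perm.sign_swap h]
  simp

theorem csign_transp {n : ℕ} (i : Fin (n - 1)) : csign (transp i) = -1 :=
  csign_swap (lo_lt_hi i).ne

/-! ### Antisymmetrisation over the values in a block -/

/-- Left multiplication by a permutation (action on values). -/
noncomputable def leftMul {n : ℕ} (w : Equiv.Perm (Fin n)) : Module.End ℂ (PermSpace n) :=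
  linearize (fun μ => w * μ)

theorem leftMul_transp {n : ℕ} (i : Fin (n - 1)) : leftMul (transp i) = leftOp i := rfl

theorem leftMul_mul {n : ℕ} (u w : Equiv.Perm (Fin n)) (v : PermSpace n) :
    leftMul (u * w) v = leftMul u (leftMul w v) := by
  have h : leftMul (u * w) = leftMul u ∘ₗ leftMul w := end_ext fun μ => by
    simp only [leftMul, LinearMap.comp_apply, linearize_single, mul_assoc]
  rw [h, LinearMap.comp_apply]

theorem leftMul_one {n : ℕ} (v : PermSpace n) : leftMul 1 v = v := by
  have h : leftMul (1 : Equiv.Perm (Fin n)) = LinearMap.id := end_ext fun μ => by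
    simp only [leftMul, linearize_single, one_mul, LinearMap.id_apply]
  rw [h, LinearMap.id_apply]

theorem leftMul_inv {n : ℕ} (w : Equiv.Perm (Fin n)) (v : PermSpace n) :
    leftMul w (leftMul w⁻¹ v) = v := by
  rw [← leftMul_mul, mul_inv_cancel, leftMul_one]

theorem linearize_apply_injective {ι : Type} [Fintype ι] [DecidableEq ι] {f : ι → ι}
    (hf : Function.Injective f) (v : ι → ℂ) (x : ι) : linearize f v (f x) = v x := by
  have h : LinearMap.proj (f x) ∘ₗ linearize f = (LinearMap.proj x : (ι → ℂ) →ₗ[ℂ] ℂ) := by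
    refine (Pi.basisFun ℂ ι).ext fun y => ?_
    rw [Pi.basisFun_apply, LinearMap.comp_apply, linearize_single, LinearMap.proj_apply,
      LinearMap.proj_apply, Pi.single_apply, Pi.single_apply]
    exact if_congr hf.eq_iff rfl rfl
  exact LinearMap.congr_fun h v

theorem leftMul_apply {n : ℕ} (w μ : Equiv.Perm (Fin n)) (v : PermSpace n) :
    leftMul w v (w * μ) = v μ :=
  linearize_apply_injective (mul_right_injective w) v μ

theorem leftMul_of_mem_antisym {n : ℕ} {B : Set (Fin n)} {v : PermSpace n}
    (hv : v ∈ antisym n (inner B)) {w : Equiv.Perm (Fin n)} (hw : w ∈ parabolic B) :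
    leftMul w v = csign w • v := by
  induction hw using Subgroup.closure_induction with
  | mem w hw =>
    obtain ⟨i, hi, rfl⟩ := hw
    rw [leftMul_transp, mem_antisym.mp hv i hi, csign_transp, neg_one_smul]
  | one => rw [leftMul_one, map_one, one_smul]
  | mul u w _ _ hu hw => rw [leftMul_mul, hw, map_smul, hu, smul_smul, map_mul, mul_comm]
  | inv w _ hw =>
    have h := congrArg (leftMul w⁻¹) hw
    rw [← leftMul_mul, inv_mul_cancel, leftMul_one, map_smul] at h
    have h1 : csign w⁻¹ * csign w = 1 := by rw [← map_mul, inv_mul_cancel, map_one]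
    calc leftMul w⁻¹ v = (csign w⁻¹ * csign w) • leftMul w⁻¹ v := by rw [h1, one_smul]
      _ = csign w⁻¹ • v := by rw [mul_smul, ← h]

open Classical in
/-- The antisymmetrisation over the group of `B`. -/
noncomputable def antisymmetrizer {n : ℕ} (B : Set (Fin n)) : Module.End ℂ (PermSpace n) :=
  ∑ w : parabolic B, csign (w : Equiv.Perm (Fin n)) • leftMul (w : Equiv.Perm (Fin n))

theorem antisymmetrizer_apply {n : ℕ} (B : Set (Fin n)) [Fintype (parabolic B)]
    (v : PermSpace n) : antisymmetrizer B v =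
      ∑ w : parabolic B, csign (w : Equiv.Perm (Fin n)) • leftMul (w : Equiv.Perm (Fin n)) v := by
  rw [antisymmetrizer, LinearMap.sum_apply]
  refine Finset.sum_congr (by congr!) fun w _ => by rw [LinearMap.smul_apply]

theorem leftMul_antisymmetrizer {n : ℕ} {B : Set (Fin n)} {u : Equiv.Perm (Fin n)}
    (hu : u ∈ parabolic B) (v : PermSpace n) :
    leftMul u (antisymmetrizer B v) = csign u • antisymmetrizer B v := by
  classical
  rw [antisymmetrizer_apply, map_sum, Finset.smul_sum]
  refine Fintype.sum_equiv (Equiv.mulLeft (⟨u, hu⟩ : parabolic B)) _ _ fun w => ?_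
  simp only [Equiv.coe_mulLeft, Subgroup.coe_mul, map_smul, leftMul_mul, smul_smul, map_mul]
  rw [← mul_assoc, csign_mul_self, one_mul]

theorem antisymmetrizer_leftMul {n : ℕ} {B : Set (Fin n)} {u : Equiv.Perm (Fin n)}
    (hu : u ∈ parabolic B) (v : PermSpace n) :
    antisymmetrizer B (leftMul u v) = csign u • antisymmetrizer B v := by
  classical
  rw [antisymmetrizer_apply, antisymmetrizer_apply, Finset.smul_sum]
  refine Fintype.sum_equiv (Equiv.mulRight (⟨u, hu⟩ : parabolic B)) _ _ fun w => ?_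
  simp only [Equiv.coe_mulRight, Subgroup.coe_mul, leftMul_mul, smul_smul, map_mul]
  rw [mul_left_comm, csign_mul_self, mul_one]

theorem antisymmetrizer_commute {n : ℕ} {B : Set (Fin n)} {u : Equiv.Perm (Fin n)}
    (hu : u ∈ parabolic Bᶜ) (v : PermSpace n) :
    antisymmetrizer B (leftMul u v) = leftMul u (antisymmetrizer B v) := by
  classical
  rw [antisymmetrizer_apply, antisymmetrizer_apply, map_sum]
  refine Finset.sum_congr rfl fun w _ => ?_
  rw [map_smul, ← leftMul_mul, ← leftMul_mul, (parabolic_commute w.2 hu).eq]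

theorem antisymmetrizer_mem {n : ℕ} (B : Set (Fin n)) (v : PermSpace n) :
    antisymmetrizer B v ∈ antisym n (inner B) := by
  rw [mem_antisym]
  intro i hi
  rw [← leftMul_transp, leftMul_antisymmetrizer (Subgroup.subset_closure ⟨i, hi, rfl⟩),
    csign_transp, neg_one_smul]

/-- Every summand equals `v`, because the sign occurs squared. Thus the antisymmetriser is, up to a
nonzero scalar, a projection onto the antisymmetric vectors. -/
theorem antisymmetrizer_of_mem {n : ℕ} {B : Set (Fin n)} {v : PermSpace n}
    (hv : v ∈ antisym n (inner B)) : antisymmetrizer B v = (Nat.card (parabolic B) : ℂ) • v := by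
  classical
  rw [antisymmetrizer_apply, Finset.sum_congr rfl (g := fun _ => v), Finset.sum_const,
    Finset.card_univ, ← Nat.card_eq_fintype_card, Nat.cast_smul_eq_nsmul]
  intro w _
  rw [leftMul_of_mem_antisym hv w.2, smul_smul, csign_mul_self, one_smul]

theorem leftMul_mem_antisym {n : ℕ} {B : Set (Fin n)} {v : PermSpace n}
    (hv : v ∈ antisym n (inner B)) {w : Equiv.Perm (Fin n)} (hw : w ∈ parabolic Bᶜ) :
    leftMul w v ∈ antisym n (inner B) := by
  rw [mem_antisym] at hv ⊢
  intro i hi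
  have hu : transp i ∈ parabolic B := Subgroup.subset_closure ⟨i, hi, rfl⟩
  rw [← leftMul_transp, ← leftMul_mul, (parabolic_commute hu hw).eq, leftMul_mul, leftMul_transp,
    hv i hi, map_neg]

/-- Modulo the vectors that are antisymmetric in two further values, the permutations of the values
outside of `B` act trivially. -/
theorem leftMul_sub_mem {n : ℕ} {B : Set (Fin n)} {w : Equiv.Perm (Fin n)}
    (hw : w ∈ parabolic Bᶜ) : ∀ v ∈ antisym n (inner B),
      leftMul w v - v ∈ ⨆ j ∈ inner Bᶜ, antisym n (insert j (inner B)) := by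
  induction hw using Subgroup.closure_induction with
  | mem w hw =>
    obtain ⟨j, hj, rfl⟩ := hw
    intro v hv
    -- For a single transposition the difference changes sign under that transposition, an
    -- involution. It keeps the antisymmetries of `B` because the two groups commute.
    refine (le_iSup₂ (f := fun j (_ : j ∈ inner Bᶜ) => antisym n (insert j (inner B))) j hj) ?_
    rw [mem_antisym]
    rintro i (rfl | hi)
    · rw [map_sub, leftMul_transp, ← leftMul_transp, ← leftMul_mul, transp, Equiv.swap_mul_self,
        leftMul_one, neg_sub]
    · have h1 := leftMul_mem_antisym hv (Subgroup.subset_closure ⟨j, hj, rfl⟩)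
      rw [map_sub, mem_antisym.mp h1 i hi, mem_antisym.mp hv i hi]
      abel
  | one =>
    intro v _
    rw [leftMul_one, sub_self]
    exact zero_mem _
  | mul u w hu hw ihu ihw =>
    intro v hv
    -- Telescoping: `u w v - v = (u (w v) - w v) + (w v - v)`.
    have h := add_mem (ihu _ (leftMul_mem_antisym hv hw)) (ihw v hv)
    rwa [sub_add_sub_cancel, ← leftMul_mul] at h
  | inv w hw ih =>
    intro v hv
    have h := neg_mem (ih _ (leftMul_mem_antisym hv (inv_mem hw)))
    rwa [leftMul_inv, neg_sub] at h

/-! ### From permutations to exterior powers -/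

theorem permSpace_hom_ext {n : ℕ} {M : Type} [AddCommMonoid M] [Module ℂ M]
    {f g : PermSpace n →ₗ[ℂ] M}
    (h : ∀ μ : Equiv.Perm (Fin n), f (Pi.single μ 1) = g (Pi.single μ 1)) : f = g :=
  (Pi.basisFun ℂ (Equiv.Perm (Fin n))).ext fun x => by rw [Pi.basisFun_apply]; exact h x

/-- The map sending a permutation `μ` to the wedge product of the positions of the values in the
block `b`. -/
noncomputable def toWedge {n k : ℕ} (b : Fin k → Fin n) :
    PermSpace n →ₗ[ℂ] ⋀[ℂ]^k (Fin n → ℂ) :=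
  (Pi.basisFun ℂ (Equiv.Perm (Fin n))).constr ℂ fun μ => wedge (⇑μ⁻¹ ∘ b)

section toWedge

variable {n k : ℕ} {b : Fin k → Fin n}

theorem toWedge_single (b : Fin k → Fin n) (μ : Equiv.Perm (Fin n)) :
    toWedge b (Pi.single μ 1) = wedge (⇑μ⁻¹ ∘ b) := by
  have h := (Pi.basisFun ℂ (Equiv.Perm (Fin n))).constr_basis ℂ
    (fun μ : Equiv.Perm (Fin n) => (wedge (⇑μ⁻¹ ∘ b))) μ
  rwa [Pi.basisFun_apply] at h

/-- Positions are read off from `μ⁻¹`, and `(μ τ)⁻¹ = τ⁻¹ μ⁻¹`; this is where the inverse in the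
restriction to `𝔖ₙ` comes from. -/
theorem toWedge_permOp (b : Fin k → Fin n) (τ : Equiv.Perm (Fin n)) (v : PermSpace n) :
    toWedge b (permOp τ v) =
      exteriorPower.map k (linearize (τ⁻¹ : Equiv.Perm (Fin n))) (toWedge b v) := by
  suffices h : toWedge b ∘ₗ permOp τ =
      exteriorPower.map k (linearize (τ⁻¹ : Equiv.Perm (Fin n))) ∘ₗ toWedge b from
    LinearMap.congr_fun h v
  refine permSpace_hom_ext fun μ => ?_
  rw [LinearMap.comp_apply, LinearMap.comp_apply, permOp, linearize_single, toWedge_single,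
    toWedge_single, map_wedge, mul_inv_rev, Equiv.Perm.coe_mul]
  rfl

/-- On generators, exchanging two values of the block exchanges two factors of the wedge product. -/
theorem toWedge_leftMul_of_mem (hb : Function.Injective b) {w : Equiv.Perm (Fin n)}
    (hw : w ∈ parabolic (Set.range b)) :
    ∀ v, toWedge b (leftMul w v) = csign w • toWedge b v := by
  induction hw using Subgroup.closure_induction with
  | mem w hw =>
    obtain ⟨i, ⟨⟨p, hp⟩, ⟨q, hq⟩⟩, rfl⟩ := hw
    have hpq : p ≠ q := fun h => (lo_lt_hi i).ne (by rw [← hp, ← hq, h])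
    suffices h : toWedge b ∘ₗ leftMul (transp i) = csign (transp i) • toWedge b from
      LinearMap.congr_fun h
    refine permSpace_hom_ext fun μ => ?_
    have h1 : ⇑(transp i * μ)⁻¹ ∘ b = (⇑μ⁻¹ ∘ b) ∘ Equiv.swap p q := by
      funext j
      have h2 : b (Equiv.swap p q j) = transp i (b j) := by
        rw [transp, ← hp, ← hq, hb.map_swap]
      simp only [Function.comp_apply, h2, mul_inv_rev, Equiv.Perm.mul_apply]
      rw [transp, Equiv.swap_inv]
    rw [LinearMap.comp_apply, LinearMap.smul_apply, leftMul, linearize_single, toWedge_single,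
      toWedge_single, h1, wedge_perm, Equiv.Perm.sign_swap hpq, csign_transp]
    simp
  | one => intro v; rw [leftMul_one, map_one, one_smul]
  | mul u w _ _ hu hw => intro v; rw [leftMul_mul, hu, hw, smul_smul, map_mul]
  | inv w _ ih =>
    intro v
    have h := ih (leftMul w⁻¹ v)
    have h1 : csign w⁻¹ * csign w = 1 := by rw [← map_mul, inv_mul_cancel, map_one]
    rw [leftMul_inv] at h
    rw [h, smul_smul, h1, one_smul]

theorem toWedge_leftOp {j : Fin (n - 1)} (hj : j ∈ inner (Set.range b)ᶜ) (v : PermSpace n) :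
    toWedge b (leftOp j v) = toWedge b v := by
  suffices h : toWedge b ∘ₗ leftOp j = toWedge b from LinearMap.congr_fun h v
  refine permSpace_hom_ext fun μ => ?_
  rw [LinearMap.comp_apply, leftOp, linearize_single, toWedge_single, toWedge_single]
  congr 1
  funext a
  rw [mul_inv_rev, Function.comp_apply, Function.comp_apply, Equiv.Perm.mul_apply, transp,
    Equiv.swap_inv, Equiv.swap_apply_of_ne_of_ne]
  · exact fun h => hj.1 ⟨a, h⟩
  · exact fun h => hj.2 ⟨a, h⟩

theorem toWedge_antisymmetrizer (hb : Function.Injective b) (v : PermSpace n) :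
    toWedge b (antisymmetrizer (Set.range b) v) =
      (Nat.card (parabolic (Set.range b)) : ℂ) • toWedge b v := by
  classical
  rw [antisymmetrizer_apply, map_sum, Finset.sum_congr rfl (g := fun _ => toWedge b v),
    Finset.sum_const, Finset.card_univ, ← Nat.card_eq_fintype_card, Nat.cast_smul_eq_nsmul]
  intro w _
  rw [map_smul, toWedge_leftMul_of_mem hb w.2, smul_smul, csign_mul_self, one_smul]

/-- On the summand of index `j`, exchanging the values `j` and `j + 1` negates the vector but does
not affect its image, which therefore equals its own negative. -/
theorem toWedge_eq_zero {v : PermSpace n}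
    (hv : v ∈ ⨆ j ∈ inner (Set.range b)ᶜ, antisym n (insert j (inner (Set.range b)))) :
    toWedge b v = 0 := by
  suffices h : (⨆ j ∈ inner (Set.range b)ᶜ, antisym n (insert j (inner (Set.range b)))) ≤
      LinearMap.ker (toWedge b) from h hv
  refine iSup₂_le fun j hj v hv => ?_
  have h1 := toWedge_leftOp hj v
  rw [mem_antisym.mp hv j (Set.mem_insert _ _), map_neg, neg_eq_iff_add_eq_zero, ← two_smul ℂ,
    smul_eq_zero] at h1
  exact h1.resolve_left two_ne_zero

/-- For injective `s`, extend `b j ↦ s j` to a permutation `σ`. Then `σ⁻¹` has the value `b j` at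
the position `s j`, and its normalised antisymmetrisation is a preimage of `wedge s`. -/
theorem exists_antisym_toWedge_eq (hb : Function.Injective b) (x : ⋀[ℂ]^k (Fin n → ℂ)) :
    ∃ v ∈ antisym n (inner (Set.range b)), toWedge b v = x := by
  suffices h : (antisym n (inner (Set.range b))).map (toWedge b) = ⊤ by
    have hx : x ∈ (antisym n (inner (Set.range b))).map (toWedge b) := h ▸ Submodule.mem_top
    exact hx
  rw [eq_top_iff, ← span_wedge, Submodule.span_le]
  rintro _ ⟨s, rfl⟩
  by_cases hs : Function.Injective s
  · obtain ⟨σ, hσ⟩ := Equiv.Perm.exists_extending_pair b s hb hs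
    refine ⟨(Nat.card (parabolic (Set.range b)) : ℂ)⁻¹ •
      antisymmetrizer (Set.range b) (Pi.single σ⁻¹ 1),
      Submodule.smul_mem _ _ (antisymmetrizer_mem _ _), ?_⟩
    rw [map_smul, toWedge_antisymmetrizer hb, inv_smul_smul₀, toWedge_single, inv_inv]
    · congr 1
      funext j
      exact hσ j
    · exact Nat.cast_ne_zero.mpr Nat.card_pos.ne'
  · simp only [Function.Injective, not_forall] at hs
    obtain ⟨i, j, h, hij⟩ := hs
    dsimp only
    rw [wedge_eq_zero h hij]
    exact zero_mem _

theorem antisym_coeff {B : Set (Fin n)} (hB : B.OrdConnected) {v : PermSpace n}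
    (hv : v ∈ antisym n (inner B)) {p q : Fin n} (hpq : p ≠ q) {μ : Equiv.Perm (Fin n)}
    (hp : μ p ∈ B) (hq : μ q ∈ B) : v (μ * Equiv.swap p q) = -v μ := by
  rw [Equiv.mul_swap_eq_swap_mul, ← leftMul_apply (Equiv.swap (μ p) (μ q)) μ v,
    leftMul_of_mem_antisym hv (swap_mem_parabolic hB hp hq), csign_swap (μ.injective.ne hpq)]
  simp

/-- A sorting operator at the positions `p`, `q` that moves the values in the block to the position
`q` acts on the exterior power by the function `p ↦ q`. -/
theorem toWedge_sort (hB : (Set.range b).OrdConnected) {p q : Fin n} (hpq : p ≠ q)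
    (φ : Equiv.Perm (Fin n) → Equiv.Perm (Fin n))
    (hφ : ∀ μ, φ μ = μ ∨ φ μ = μ * Equiv.swap p q) (hφ' : ∀ μ, φ (μ * Equiv.swap p q) = φ μ)
    (hmove : ∀ μ, μ p ∈ Set.range b → μ q ∉ Set.range b → φ μ = μ * Equiv.swap p q)
    (hstay : ∀ μ, μ p ∉ Set.range b → μ q ∈ Set.range b → φ μ = μ)
    {v : PermSpace n} (hv : v ∈ antisym n (inner (Set.range b))) :
    toWedge b (linearize φ v) =
      exteriorPower.map k (linearize fun x => if x = p then q else x) (toWedge b v) := by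
  classical
  -- The defect of the claimed identity. It vanishes on most basis vectors; the others cancel in
  -- pairs on antisymmetric vectors.
  let D : PermSpace n →ₗ[ℂ] ⋀[ℂ]^k (Fin n → ℂ) := toWedge b ∘ₗ linearize φ -
    exteriorPower.map k (linearize fun x => if x = p then q else x) ∘ₗ toWedge b
  have hD : ∀ μ, D (Pi.single μ 1) =
      wedge (⇑(φ μ)⁻¹ ∘ b) - wedge ((fun x => if x = p then q else x) ∘ (⇑μ⁻¹ ∘ b)) := by
    intro μ
    simp only [D, LinearMap.sub_apply, LinearMap.comp_apply, linearize_single, toWedge_single,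
      map_wedge]
  -- If both values lie in the block, the function sends `p` and `q` to the same point and kills the
  -- wedge, so only the sorted term remains.
  have hboth : ∀ μ : Equiv.Perm (Fin n), μ p ∈ Set.range b → μ q ∈ Set.range b →
      D (Pi.single μ 1) = wedge (⇑(φ μ)⁻¹ ∘ b) := by
    rintro μ ⟨i, hi⟩ ⟨j, hj⟩
    rw [hD, wedge_eq_zero (s := (fun x => if x = p then q else x) ∘ (⇑μ⁻¹ ∘ b)) (i := i) (j := j),
      sub_zero]
    · simp [hi, hj]
    · intro hij
      exact hpq (μ.injective (by rw [← hi, ← hj, hij]))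
  have hnot : ∀ μ : Equiv.Perm (Fin n), ¬ (μ p ∈ Set.range b ∧ μ q ∈ Set.range b) →
      D (Pi.single μ 1) = 0 := by
    intro μ hμ
    rw [hD, sub_eq_zero]
    congr 1
    funext j
    simp only [Function.comp_apply]
    have hj : μ (μ⁻¹ (b j)) ∈ Set.range b := ⟨j, (μ.apply_symm_apply _).symm⟩
    by_cases h1 : μ p ∈ Set.range b
    · have h2 : μ q ∉ Set.range b := fun h2 => hμ ⟨h1, h2⟩
      have h3 : μ⁻¹ (b j) ≠ q := fun h3 => h2 (h3 ▸ hj)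
      rw [hmove μ h1 h2, mul_inv_rev, Equiv.Perm.mul_apply, Equiv.swap_inv, Equiv.swap_apply_def,
        if_neg h3]
    · have h3 : μ⁻¹ (b j) ≠ p := fun h3 => h1 (h3 ▸ hj)
      rw [if_neg h3]
      by_cases h2 : μ q ∈ Set.range b
      · rw [hstay μ h1 h2]
      · have h4 : μ⁻¹ (b j) ≠ q := fun h4 => h2 (h4 ▸ hj)
        rcases hφ μ with h | h
        · rw [h]
        · rw [h, mul_inv_rev, Equiv.Perm.mul_apply, Equiv.swap_inv,
            Equiv.swap_apply_of_ne_of_ne h3 h4]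
  have hsum : D v = ∑ μ, v μ • D (Pi.single μ 1) := by
    conv_lhs => rw [pi_eq_sum_univ' v, map_sum]
    refine Finset.sum_congr rfl fun μ _ => ?_
    rw [map_smul]
  -- Reindex by `μ ↦ μ * swap p q`. When both values lie in the block, the coefficient changes sign
  -- and the sorted permutation stays the same; all other terms are zero.
  have hneg : D v = -D v := by
    rw [hsum, ← Finset.sum_neg_distrib]
    refine Fintype.sum_equiv (Equiv.mulRight (Equiv.swap p q)) _ _ fun μ => ?_
    change v μ • D (Pi.single μ 1) =
      -(v (μ * Equiv.swap p q) • D (Pi.single (μ * Equiv.swap p q) 1))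
    have h1 : (μ * Equiv.swap p q) p = μ q := by simp
    have h2 : (μ * Equiv.swap p q) q = μ p := by simp
    by_cases h : μ p ∈ Set.range b ∧ μ q ∈ Set.range b
    · rw [antisym_coeff hB hv hpq h.1 h.2, hboth μ h.1 h.2,
        hboth _ (h1 ▸ h.2) (h2 ▸ h.1), hφ']
      module
    · rw [hnot μ h, hnot (μ * Equiv.swap p q) (by rw [h1, h2]; exact fun h' => h h'.symm),
        smul_zero, smul_zero, neg_zero]
  have hzero : D v = 0 := by
    rw [eq_neg_iff_add_eq_zero, ← two_smul ℂ, smul_eq_zero] at hneg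
    exact hneg.resolve_left two_ne_zero
  exact sub_eq_zero.mp hzero

end toWedge

/-! ### The modules `Pₙᵏ` are exterior powers -/

/-- The increasing enumeration of the block of antisymmetrised values. -/
def Side.block (c : Side) {n k : ℕ} (hk : k ≤ n) (j : Fin k) : Fin n :=
  match c with
  | .first => ⟨j, by omega⟩
  | .last => ⟨n - k + j, by omega⟩

section block

variable (c : Side) {n k : ℕ} (hk : k ≤ n)

theorem Side.block_injective : Function.Injective (c.block hk) := by
  intro a b h
  cases c <;> simp only [Side.block, Fin.ext_iff] at h ⊢ <;> omega

theorem Side.mem_range_block_first {x : Fin n} :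
    x ∈ Set.range (Side.first.block hk) ↔ (x : ℕ) < k := by
  constructor
  · rintro ⟨j, rfl⟩
    exact j.2
  · exact fun h => ⟨⟨x, h⟩, rfl⟩

theorem Side.mem_range_block_last {x : Fin n} :
    x ∈ Set.range (Side.last.block hk) ↔ n ≤ x + k := by
  constructor
  · rintro ⟨j, rfl⟩
    simp only [Side.block]
    omega
  · intro h
    refine ⟨⟨x + k - n, by omega⟩, Fin.ext ?_⟩
    simp only [Side.block]
    omega

theorem Side.ordConnected_range_block : (Set.range (c.block hk)).OrdConnected := by
  refine ⟨fun x hx y hy z hz => ?_⟩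
  cases c
  · rw [Side.mem_range_block_first] at hy ⊢
    exact lt_of_le_of_lt hz.2 hy
  · rw [Side.mem_range_block_last] at hx ⊢
    have h : (x : ℕ) ≤ z := hz.1
    omega

theorem Side.ordConnected_compl_range_block : (Set.range (c.block hk))ᶜ.OrdConnected := by
  refine ⟨fun x hx y hy z hz => ?_⟩
  rw [Set.mem_compl_iff] at hx hy ⊢
  cases c
  · rw [Side.mem_range_block_first] at hx ⊢
    have h : (x : ℕ) ≤ z := hz.1
    omega
  · rw [Side.mem_range_block_last] at hy ⊢
    have h : (z : ℕ) ≤ y := hz.2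
    omega

theorem antiIdx_eq : antiIdx c n k = inner (Set.range (c.block hk)) := by
  ext i
  cases c
  · simp only [antiIdx, inner, Set.mem_ofPred_eq, Side.mem_range_block_first, lo, hi]
    omega
  · simp only [antiIdx, inner, Set.mem_ofPred_eq, Side.mem_range_block_last, lo, hi]
    omega

theorem symIdx_eq : symIdx c n k = inner (Set.range (c.block hk))ᶜ := by
  ext i
  cases c
  · simp only [symIdx, inner, Set.mem_ofPred_eq, Set.mem_compl_iff, Side.mem_range_block_first,
      lo, hi]
    omega
  · simp only [symIdx, inner, Set.mem_ofPred_eq, Set.mem_compl_iff, Side.mem_range_block_last,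
      lo, hi]
    omega

theorem topPart_eq : topPart c n k = antisym n (inner (Set.range (c.block hk))) := by
  rw [topPart, antiIdx_eq c hk]

theorem subPart_eq : subPart c n k = ⨆ j ∈ inner (Set.range (c.block hk))ᶜ,
    antisym n (insert j (inner (Set.range (c.block hk)))) := by
  rw [subPart, symIdx_eq c hk, antiIdx_eq c hk]

theorem antisymmetrizer_mem_topPart (v : PermSpace n) :
    antisymmetrizer (Set.range (c.block hk)) v ∈ topPart c n k := by
  rw [topPart_eq c hk]
  exact antisymmetrizer_mem _ v

/-- The class of the antisymmetrisation of a permutation. -/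
noncomputable def antisymClass (μ : Equiv.Perm (Fin n)) : ExtQuot c n k :=
  Submodule.Quotient.mk
    ⟨antisymmetrizer (Set.range (c.block hk)) (Pi.single μ 1), antisymmetrizer_mem_topPart c hk _⟩

/-- The hypothesis says that `μ * ν⁻¹` preserves the block, so it splits into a factor inside the
block, which contributes a sign, and one outside, which is trivial modulo `subPart`. -/
theorem antisymClass_congr {μ ν : Equiv.Perm (Fin n)}
    (h : ∀ x, μ x ∈ Set.range (c.block hk) ↔ ν x ∈ Set.range (c.block hk)) :
    ∃ r : ℂ, antisymClass c hk μ = r • antisymClass c hk ν := by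
  obtain ⟨u, hu, w, hw, huw⟩ := exists_parabolic_mul (c.ordConnected_range_block hk)
    (c.ordConnected_compl_range_block hk) (σ := μ * ν⁻¹)
    (fun x => by
      rw [Equiv.Perm.mul_apply, h]
      exact iff_of_eq (congrArg (· ∈ _) (ν.apply_symm_apply x)))
  have hμ : (Pi.single μ 1 : PermSpace n) = leftMul u (leftMul w (Pi.single ν 1)) := by
    rw [← leftMul_mul, ← huw, leftMul, linearize_single, inv_mul_cancel_right]
  refine ⟨csign u, ?_⟩
  rw [antisymClass, antisymClass, ← Submodule.Quotient.mk_smul, Submodule.Quotient.eq]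
  change antisymmetrizer _ _ - csign u • antisymmetrizer _ _ ∈ subPart c n k
  rw [hμ, antisymmetrizer_leftMul hu, antisymmetrizer_commute hw, ← smul_sub, subPart_eq c hk]
  exact Submodule.smul_mem _ _ (leftMul_sub_mem hw _ (antisymmetrizer_mem _ _))

/-- The antisymmetriser acts on `topPart` as multiplication by a nonzero integer, so it maps the
whole space onto `topPart`, and the images of the basis permutations span. -/
theorem span_antisymClass : Submodule.span ℂ (Set.range (antisymClass c hk)) = ⊤ := by
  rw [eq_top_iff]
  rintro x -
  obtain ⟨⟨v, hv⟩, rfl⟩ := Submodule.Quotient.mk_surjective _ x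
  have hv' : v ∈ antisym n (inner (Set.range (c.block hk))) := by rwa [← topPart_eq]
  have hN : (Nat.card (parabolic (Set.range (c.block hk))) : ℂ) ≠ 0 :=
    Nat.cast_ne_zero.mpr Nat.card_pos.ne'
  let T : PermSpace n →ₗ[ℂ] ExtQuot c n k := Submodule.mkQ _ ∘ₗ
    (antisymmetrizer (Set.range (c.block hk))).codRestrict (topPart c n k)
      (antisymmetrizer_mem_topPart c hk)
  have hT : T ((Nat.card (parabolic (Set.range (c.block hk))) : ℂ)⁻¹ • v) =
      Submodule.Quotient.mk ⟨v, hv⟩ := by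
    refine congrArg (Submodule.Quotient.mk) (Subtype.ext ?_)
    change antisymmetrizer _ _ = v
    rw [map_smul, antisymmetrizer_of_mem hv', inv_smul_smul₀ hN]
  rw [← hT]
  have hrange : LinearMap.range T ≤ Submodule.span ℂ (Set.range (antisymClass c hk)) := by
    rw [LinearMap.range_eq_map, ← (Pi.basisFun ℂ (Equiv.Perm (Fin n))).span_eq,
      Submodule.map_span, Submodule.span_le]
    rintro _ ⟨_, ⟨μ, rfl⟩, rfl⟩
    rw [Pi.basisFun_apply]
    exact Submodule.subset_span ⟨μ, rfl⟩
  exact hrange (LinearMap.mem_range_self _ _)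

/-- By `antisymClass_congr` one class for each `k`-subset of positions is enough to span. -/
theorem finrank_extQuot_le (c : Side) {n k : ℕ} (hk : k ≤ n) :
    Module.finrank ℂ (ExtQuot c n k) ≤ n.choose k := by
  classical
  have hex : ∀ S : Set.powersetCard (Fin n) k, ∃ x : ExtQuot c n k,
      ∀ μ : Equiv.Perm (Fin n), (∀ p, μ p ∈ Set.range (c.block hk) ↔ p ∈ S.1) →
        ∃ r : ℂ, antisymClass c hk μ = r • x := by
    intro S
    by_cases h : ∃ ν : Equiv.Perm (Fin n), ∀ p, ν p ∈ Set.range (c.block hk) ↔ p ∈ S.1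
    · obtain ⟨ν, hν⟩ := h
      exact ⟨antisymClass c hk ν, fun μ hμ =>
        antisymClass_congr c hk fun p => (hμ p).trans (hν p).symm⟩
    · exact ⟨0, fun μ hμ => absurd ⟨μ, hμ⟩ h⟩
  choose x hx using hex
  have hspan : Submodule.span ℂ (Set.range x) = ⊤ := by
    rw [eq_top_iff, ← span_antisymClass c hk, Submodule.span_le]
    rintro _ ⟨μ, rfl⟩
    let S : Finset (Fin n) := Finset.univ.image (⇑μ⁻¹ ∘ c.block hk)
    have hS : S.card = k := by
      rw [Finset.card_image_of_injective _ ((μ⁻¹).injective.comp (c.block_injective hk)),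
        Finset.card_univ, Fintype.card_fin]
    obtain ⟨r, hr⟩ := hx ⟨S, hS⟩ μ (fun p => by
      simp only [S, Finset.mem_image, Finset.mem_univ, true_and, Set.mem_range,
        Function.comp_apply]
      exact exists_congr fun j => (Equiv.symm_apply_eq μ).symm)
    rw [hr]
    exact Submodule.smul_mem _ _ (Submodule.subset_span ⟨_, rfl⟩)
  calc Module.finrank ℂ (ExtQuot c n k) = (Set.range x).finrank ℂ := by
        rw [Set.finrank, hspan, finrank_top]
    _ ≤ Fintype.card (Set.powersetCard (Fin n) k) := finrank_range_le_card x
    _ = n.choose k := by rw [← Nat.card_eq_fintype_card, Set.powersetCard.card, Nat.card_fin]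

/-- The map from `Pₙᵏ` to the exterior power. -/
noncomputable def extQuotToWedge : ExtQuot c n k →ₗ[ℂ] ⋀[ℂ]^k (Fin n → ℂ) :=
  Submodule.liftQ _ (toWedge (c.block hk) ∘ₗ (topPart c n k).subtype) fun v hv =>
    toWedge_eq_zero (by rw [← subPart_eq]; exact hv)

theorem extQuotToWedge_surjective : Function.Surjective (extQuotToWedge c hk) := by
  intro x
  obtain ⟨v, hv, rfl⟩ := exists_antisym_toWedge_eq (c.block_injective hk) x
  exact ⟨Submodule.Quotient.mk ⟨v, by rwa [topPart_eq c hk]⟩, rfl⟩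

/-- A surjection onto a space of dimension `n.choose k` from one of dimension at most `n.choose k`.
-/
theorem extQuotToWedge_bijective : Function.Bijective (extQuotToWedge c hk) := by
  refine ⟨?_, extQuotToWedge_surjective c hk⟩
  rw [LinearMap.injective_iff_surjective_of_finrank_eq_finrank]
  · exact extQuotToWedge_surjective c hk
  · have h : Module.finrank ℂ (⋀[ℂ]^k (Fin n → ℂ)) = n.choose k := by
      rw [exteriorPower.finrank_eq, Module.finrank_fin_fun]
    refine le_antisymm (h ▸ finrank_extQuot_le c hk) ?_
    exact LinearMap.finrank_le_finrank_of_surjective (extQuotToWedge_surjective c hk)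

/-- The isomorphism between `Pₙᵏ` and the exterior power. -/
noncomputable def extQuotEquiv : ExtQuot c n k ≃ₗ[ℂ] ⋀[ℂ]^k (Fin n → ℂ) :=
  LinearEquiv.ofBijective (extQuotToWedge c hk) (extQuotToWedge_bijective c hk)

theorem extQuotEquiv_apply (h : HS n) (v : topPart c n k) :
    extQuotEquiv c hk ((extQuotRep c n k h).unop (Submodule.Quotient.mk v)) =
      toWedge (c.block hk) (h.1.unop v) := rfl

theorem extQuotEquiv_mk (v : topPart c n k) :
    extQuotEquiv c hk (Submodule.Quotient.mk v) = toWedge (c.block hk) v := rfl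

theorem extQuotEquiv_perm (τ : Equiv.Perm (Fin n)) (x : ExtQuot c n k) :
    extQuotEquiv c hk ((extQuotRep c n k (HS.perm τ)).unop x) =
      exteriorPower.map k (linearize (τ⁻¹ : Equiv.Perm (Fin n))) (extQuotEquiv c hk x) := by
  obtain ⟨v, rfl⟩ := Submodule.Quotient.mk_surjective _ x
  rw [extQuotEquiv_apply, extQuotEquiv_mk]
  exact toWedge_permOp _ _ _

theorem extRep_ofNDF (f : NDF n) (y : ⋀[ℂ]^k (Fin n → ℂ)) :
    (extRep n k (ofNDF f)).unop y = exteriorPower.map k (linearize f.unop) y := by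
  rw [extRep, MonoidAlgebra.lift_of]
  rfl

/-- Sorting forgets the initial order of the two entries; this is the invariance that `toWedge_sort`
requires for its pairwise cancellation. -/
theorem sort_mul_swap {n : ℕ} {p q : Fin n} (hpq : p ≠ q) (μ : Equiv.Perm (Fin n)) :
    (if (μ * Equiv.swap p q) p < (μ * Equiv.swap p q) q then μ * Equiv.swap p q
      else μ * Equiv.swap p q * Equiv.swap p q) = if μ p < μ q then μ else μ * Equiv.swap p q := by
  have h1 : (μ * Equiv.swap p q) p = μ q := by simp
  have h2 : (μ * Equiv.swap p q) q = μ p := by simp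
  rw [h1, h2, mul_assoc, Equiv.swap_mul_self, mul_one]
  rcases lt_or_gt_of_ne (μ.injective.ne hpq) with h | h
  · rw [if_neg h.asymm, if_pos h]
  · rw [if_pos h, if_neg h.asymm]

/-- Sorting the positions `p`, `q` increasingly acts on the exterior powers by `p ↦ q` if the block
consists of the largest values, and by `q ↦ p` if it consists of the smallest values. -/
theorem toWedge_sort_lt {p q : Fin n} (hpq : p ≠ q) {v : PermSpace n} (hv : v ∈ topPart c n k) :
    toWedge (c.block hk)
        (linearize (fun μ : Equiv.Perm (Fin n) => if μ p < μ q then μ else μ * Equiv.swap p q) v) =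
      exteriorPower.map k (linearize fun x => match c with
        | .first => if x = q then p else x
        | .last => if x = p then q else x) (toWedge (c.block hk) v) := by
  rw [topPart_eq c hk] at hv
  cases c
  · refine toWedge_sort (Side.first.ordConnected_range_block hk) hpq.symm _ (fun μ => ?_)
      (fun μ => ?_) (fun μ h1 h2 => ?_) (fun μ h1 h2 => ?_) hv
    · rw [Equiv.swap_comm]
      split_ifs
      exacts [Or.inl rfl, Or.inr rfl]
    · rw [Equiv.swap_comm]
      exact sort_mul_swap hpq μ
    · rw [Side.mem_range_block_first] at h1 h2
      rw [Equiv.swap_comm, if_neg]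
      rw [Fin.lt_def]
      omega
    · rw [Side.mem_range_block_first] at h1 h2
      rw [if_pos]
      rw [Fin.lt_def]
      omega
  · refine toWedge_sort (Side.last.ordConnected_range_block hk) hpq _ (fun μ => ?_)
      (fun μ => ?_) (fun μ h1 h2 => ?_) (fun μ h1 h2 => ?_) hv
    · split_ifs
      exacts [Or.inl rfl, Or.inr rfl]
    · exact sort_mul_swap hpq μ
    · rw [Side.mem_range_block_last] at h1 h2
      rw [if_neg]
      rw [Fin.lt_def]
      omega
    · rw [Side.mem_range_block_last] at h1 h2
      rw [if_pos]
      rw [Fin.lt_def]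
      omega

theorem extQuotEquiv_π (i : Fin (n - 1)) (x : ExtQuot c n k) :
    extQuotEquiv c hk ((extQuotRep c n k (HS.π i)).unop x) =
      (extRep n k (ofNDF (c.sortFun i))).unop (extQuotEquiv c hk x) := by
  obtain ⟨v, rfl⟩ := Submodule.Quotient.mk_surjective _ x
  rw [extQuotEquiv_apply, extQuotEquiv_mk, extRep_ofNDF]
  -- A decreasing sort is an increasing sort with the two positions taken in the opposite order.
  have h := toWedge_sort_lt c hk (lo_lt_hi i).ne' v.2
  rw [Equiv.swap_comm] at h
  cases c <;> exact h

theorem extQuotEquiv_πbar (i : Fin (n - 1)) (x : ExtQuot c n k) :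
    extQuotEquiv c hk ((extQuotRep c n k (HS.πbar i)).unop x) =
      (extRep n k (ofNDF (c.sortBarFun i))).unop (extQuotEquiv c hk x) := by
  obtain ⟨v, rfl⟩ := Submodule.Quotient.mk_surjective _ x
  rw [extQuotEquiv_apply, extQuotEquiv_mk, extRep_ofNDF]
  have h := toWedge_sort_lt c hk (lo_lt_hi i).ne v.2
  cases c <;> exact h

end block

/-! ### The morphism from `H𝔖ₙ` to the algebra of nondecreasing functions -/

/-- Transport of operators along a linear isomorphism. -/
noncomputable def conjOp {V W : Type} [AddCommGroup V] [Module ℂ V] [AddCommGroup W] [Module ℂ W]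
    (e : V ≃ₗ[ℂ] W) : (Module.End ℂ V)ᵐᵒᵖ ≃ₐ[ℂ] (Module.End ℂ W)ᵐᵒᵖ :=
  AlgEquiv.op (e.conjAlgEquiv ℂ)

theorem conjOp_apply {V W : Type} [AddCommGroup V] [Module ℂ V] [AddCommGroup W] [Module ℂ W]
    (e : V ≃ₗ[ℂ] W) (T : (Module.End ℂ V)ᵐᵒᵖ) (y : W) :
    (conjOp e T).unop y = e (T.unop (e.symm y)) := rfl

theorem conjOp_eq_iff {V W : Type} [AddCommGroup V] [Module ℂ V] [AddCommGroup W] [Module ℂ W]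
    (e : V ≃ₗ[ℂ] W) (T : (Module.End ℂ V)ᵐᵒᵖ) (U : (Module.End ℂ W)ᵐᵒᵖ) :
    conjOp e T = U ↔ ∀ x, e (T.unop x) = U.unop (e x) := by
  constructor
  · rintro rfl x
    rw [conjOp_apply, e.symm_apply_apply]
  · intro h
    apply unop_injective
    refine LinearMap.ext fun y => ?_
    rw [conjOp_apply, h, e.apply_symm_apply]

theorem HS.πbar_eq {n : ℕ} (i : Fin (n - 1)) : (HS.πbar i : HS n) = 1 + HS.σ i - HS.π i :=
  Subtype.ext (congrArg op (sortBarOp_eq i))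

theorem HS.σ_eq {n : ℕ} (i : Fin (n - 1)) : (HS.σ i : HS n) = HS.π i + HS.πbar i - 1 := by
  rw [HS.πbar_eq]; abel

/-- Since `σ = π + π̄ - 1`, the transpositions can be traded for the increasing sorts. Unlike `σ`,
both kinds of sort correspond to elements of the monoid `NDFₙ`. -/
theorem adjoin_HS (n : ℕ) :
    Algebra.adjoin ℂ (Set.range (HS.π (n := n)) ∪ Set.range (HS.πbar (n := n))) = ⊤ := by
  have hπ : ∀ i, HS.π i ∈ Algebra.adjoin ℂ
      (Set.range (HS.π (n := n)) ∪ Set.range (HS.πbar (n := n))) := fun i =>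
    Algebra.subset_adjoin (Or.inl ⟨i, rfl⟩)
  have hπbar : ∀ i, HS.πbar i ∈ Algebra.adjoin ℂ
      (Set.range (HS.π (n := n)) ∪ Set.range (HS.πbar (n := n))) := fun i =>
    Algebra.subset_adjoin (Or.inr ⟨i, rfl⟩)
  have hσ : ∀ i, HS.σ i ∈ Algebra.adjoin ℂ
      (Set.range (HS.π (n := n)) ∪ Set.range (HS.πbar (n := n))) := by
    intro i
    have h : HS.σ i = HS.π i + HS.πbar i + (-1 : ℂ) • (1 : HS n) := by rw [HS.σ_eq]; module
    rw [h]
    exact add_mem (add_mem (hπ i) (hπbar i)) (Subalgebra.smul_mem _ (one_mem _) _)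
  rw [eq_top_iff]
  rintro ⟨h, hh⟩ -
  induction hh using Algebra.adjoin_induction with
  | mem x hx =>
    rcases hx with ⟨i, rfl⟩ | ⟨i, rfl⟩
    · exact hσ i
    · exact hπ i
  | algebraMap r => exact Subalgebra.algebraMap_mem _ r
  | add x y hx hy ihx ihy => exact add_mem ihx ihy
  | mul x y hx hy ihx ihy => exact mul_mem ihx ihy

/-- The isomorphisms between the modules `Pₙᵏ` and the exterior powers. -/
noncomputable abbrev extEquiv (c : Side) {n : ℕ} (k : Fin n) :
    ExtQuot c n (k + 1) ≃ₗ[ℂ] ⋀[ℂ]^((k : ℕ) + 1) (Fin n → ℂ) :=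
  extQuotEquiv c k.isLt

theorem extRep_ext {n : ℕ} (hn : 1 ≤ n) {a b : MonoidAlgebra ℂ (NDF n)}
    (h : ∀ k : Fin n, extRep n (k + 1) a = extRep n (k + 1) b) : a = b := by
  rw [← sub_eq_zero]
  exact eq_zero_of_extRep hn _ fun k => by rw [map_sub, h, sub_self]

/-- The algebra of `NDFₙ` embeds by `R` into the product of the operator algebras, and the action
`S` of `H𝔖ₙ` takes its generators into the range of `R`. So `Φ = R⁻¹ ∘ S` is a morphism, without any
presentation of `H𝔖ₙ`. -/
theorem exists_hom_NDF {n : ℕ} (hn : 1 ≤ n) (c : Side) :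
    ∃ Φ : HS n →ₐ[ℂ] MonoidAlgebra ℂ (NDF n), ∀ (h : HS n) (k : Fin n),
      conjOp (extEquiv c k) (extQuotRep c n (k + 1) h) = extRep n (k + 1) (Φ h) := by
  let R : MonoidAlgebra ℂ (NDF n) →ₐ[ℂ]
      ∀ k : Fin n, (Module.End ℂ (⋀[ℂ]^((k : ℕ) + 1) (Fin n → ℂ)))ᵐᵒᵖ :=
    AlgHom.pi fun k : Fin n => extRep n (k + 1)
  let S : HS n →ₐ[ℂ] ∀ k : Fin n, (Module.End ℂ (⋀[ℂ]^((k : ℕ) + 1) (Fin n → ℂ)))ᵐᵒᵖ :=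
    AlgHom.pi fun k : Fin n =>
      (conjOp (extEquiv c k)).toAlgHom.comp (extQuotRep c n (k + 1))
  have hR : Function.Injective R := fun a b hab => extRep_ext hn fun k => congrFun hab k
  have hS : ∀ h, S h ∈ R.range := by
    suffices hle : (⊤ : Subalgebra ℂ (HS n)) ≤ R.range.comap S from fun h => hle Algebra.mem_top
    rw [← adjoin_HS, Algebra.adjoin_le_iff]
    rintro _ (⟨i, rfl⟩ | ⟨i, rfl⟩)
    · exact ⟨ofNDF (c.sortFun i), funext fun k =>
        ((conjOp_eq_iff _ _ _).mpr (extQuotEquiv_π c k.isLt i)).symm⟩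
    · exact ⟨ofNDF (c.sortBarFun i), funext fun k =>
        ((conjOp_eq_iff _ _ _).mpr (extQuotEquiv_πbar c k.isLt i)).symm⟩
  refine ⟨(AlgEquiv.ofInjective R hR).symm.toAlgHom.comp (S.codRestrict R.range hS),
    fun h k => ?_⟩
  have h1 : R ((AlgEquiv.ofInjective R hR).symm (S.codRestrict R.range hS h)) = S h :=
    congrArg Subtype.val
      ((AlgEquiv.ofInjective R hR).apply_symm_apply (S.codRestrict R.range hS h))
  exact (congrFun h1 k).symm

/-! ### Generators of the subalgebras `Hₙ(0)` and `Hₙ(-1)` and of their images. -/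

theorem MonoidAlgebra_range_eq_adjoin {M A : Type} [Monoid M] [Semiring A] [Algebra ℂ A]
    (G : MonoidAlgebra ℂ M →ₐ[ℂ] A) {ι : Type} {s : ι → M}
    (hs : Submonoid.closure (Set.range s) = ⊤) :
    G.range = Algebra.adjoin ℂ (Set.range fun i => G (MonoidAlgebra.of ℂ M (s i))) := by
  refine le_antisymm ?_ ?_
  · rintro _ ⟨x, rfl⟩
    have hof : ∀ m, G (MonoidAlgebra.of ℂ M m) ∈
        Algebra.adjoin ℂ (Set.range fun i => G (MonoidAlgebra.of ℂ M (s i))) := by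
      intro m
      have hm : m ∈ Submonoid.closure (Set.range s) := hs ▸ Submonoid.mem_top m
      induction hm using Submonoid.closure_induction with
      | mem m hm => obtain ⟨i, rfl⟩ := hm; exact Algebra.subset_adjoin ⟨i, rfl⟩
      | one => rw [map_one, map_one]; exact one_mem _
      | mul a b _ _ ha hb => rw [map_mul, map_mul]; exact mul_mem ha hb
    induction x using MonoidAlgebra.induction_on with
    | of m => exact hof m
    | add a b ha hb =>
      change G (a + b) ∈ Algebra.adjoin ℂ _
      rw [map_add]; exact add_mem ha hb
    | smul r a ha =>
      change G (r • a) ∈ Algebra.adjoin ℂ _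
      rw [map_smul]; exact Subalgebra.smul_mem _ ha r
  · rw [Algebra.adjoin_le_iff]
    rintro _ ⟨i, rfl⟩
    exact ⟨_, rfl⟩

/-- Allows `Tᵢ` to be replaced by `πᵢ = Tᵢ + 1` at `q = 0` and by `√-1 (1 + Tᵢ)` at `q = -1`. -/
theorem adjoin_affine {A ι : Type} [Ring A] [Algebra ℂ A] (y : ι → A) {r : ℂ} (hr : r ≠ 0)
    (t : ℂ) : Algebra.adjoin ℂ (Set.range fun i => r • y i + t • 1) =
      Algebra.adjoin ℂ (Set.range y) := by
  refine le_antisymm ?_ ?_ <;> rw [Algebra.adjoin_le_iff] <;> rintro _ ⟨i, rfl⟩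
  · exact add_mem (Subalgebra.smul_mem _ (Algebra.subset_adjoin (Set.mem_range_self i)) r)
      (Subalgebra.smul_mem _ (one_mem _) t)
  · have h : y i = r⁻¹ • ((r • y i + t • 1) - t • 1) := by
      rw [add_sub_cancel_right, inv_smul_smul₀ hr]
    rw [SetLike.mem_coe, h]
    exact Subalgebra.smul_mem _ (sub_mem (Algebra.subset_adjoin (Set.mem_range_self i))
      (Subalgebra.smul_mem _ (one_mem _) t)) _

theorem exists_equiv_of_range_eq {A B : Type} [Semiring A] [Algebra ℂ A] [Semiring B]
    [Algebra ℂ B] (J : A →ₐ[ℂ] B) (hJ : Function.Injective J) {S : Subalgebra ℂ B}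
    (hS : J.range = S) : ∃ ψ : A ≃ₐ[ℂ] S, ∀ a, (ψ a : B) = J a := by
  subst hS
  exact ⟨AlgEquiv.ofInjective J hJ, fun _ => rfl⟩

theorem closure_NDPF_π (n : ℕ) : Submonoid.closure (Set.range (NDPF.π (n := n))) = ⊤ := by
  apply Submonoid.map_injective_of_injective (f := (NDPF n).subtype) Subtype.val_injective
  rw [MonoidHom.map_mclosure, ← MonoidHom.mrange_eq_map, Submonoid.mrange_subtype,
    ← Set.range_comp]
  exact (NDPF_eq_closure n).symm

theorem hecke_zero (n : ℕ) : hecke n 0 = Algebra.adjoin ℂ (Set.range (HS.π (n := n))) := by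
  rw [hecke, ← adjoin_affine HS.π one_ne_zero (-1)]
  congr 2
  funext i
  rw [HS.T]
  module

theorem hecke_neg_one (n : ℕ) : hecke n (-1) =
    Algebra.adjoin ℂ (Set.range fun i => Complex.I • (1 + HS.T (n := n) (-1) i)) := by
  rw [hecke, ← adjoin_affine (HS.T (-1)) Complex.I_ne_zero Complex.I]
  congr 2
  funext i
  module

theorem one_add_T_neg_one {n : ℕ} (i : Fin (n - 1)) :
    1 + HS.T (n := n) (-1) i = HS.π i - HS.πbar i := by
  rw [HS.T, HS.σ_eq]
  module

/-- The embedding of `NDPFₙ` into `NDFₙ` corresponding to the action of `Hₙ(0)`. -/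
def Side.embed (c : Side) (n : ℕ) : NDPF n →* NDF n :=
  match c with
  | .first => (revConj n).toMonoidHom.comp (NDPF n).subtype
  | .last => (NDPF n).subtype

theorem Side.embed_injective (c : Side) (n : ℕ) : Function.Injective (c.embed n) := by
  cases c
  · exact (revConj n).injective.comp Subtype.val_injective
  · exact Subtype.val_injective

theorem Side.embed_π (c : Side) {n : ℕ} (i : Fin (n - 1)) :
    c.embed n (NDPF.π (c.idx i)) = c.sortFun i := by
  cases c
  · exact (revConj_piFun _).trans (congrArg _ i.rev_rev)
  · rfl

theorem Side.idx_surjective (c : Side) (n : ℕ) : Function.Surjective (c.idx (n := n)) := by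
  cases c
  · exact Fin.rev_surjective
  · exact Function.surjective_id

/-- Transport the exterior powers back to the `Pₙᵏ`. Since `K` is injective, kernels and images
under `ρ` can be computed with `Φ` instead. -/
theorem exists_faithful_rep {n : ℕ} (hn : 1 ≤ n) (c : Side)
    {Φ : HS n →ₐ[ℂ] MonoidAlgebra ℂ (NDF n)} (hΦ : ∀ (h : HS n) (k : Fin n),
      conjOp (extEquiv c k) (extQuotRep c n (k + 1) h) = extRep n (k + 1) (Φ h)) :
    ∃ K : MonoidAlgebra ℂ (NDF n) →ₐ[ℂ] (Module.End ℂ (⨁ k : Fin n, ExtQuot c n (k + 1)))ᵐᵒᵖ,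
      Function.Injective K ∧ ∀ h, K (Φ h) = HSRep c n h := by
  let ρ : ∀ k : Fin n, MonoidAlgebra ℂ (NDF n) →ₐ[ℂ] (Module.End ℂ (ExtQuot c n (k + 1)))ᵐᵒᵖ :=
    fun k => (conjOp (extEquiv c k)).symm.toAlgHom.comp (extRep n (k + 1))
  refine ⟨directSumRep ρ, ?_, fun h => ?_⟩
  · intro a b hab
    rw [directSumRep_eq_iff] at hab
    exact extRep_ext hn fun k => (conjOp (extEquiv c k)).symm.injective (hab k)
  · have h1 : ∀ k, ρ k (Φ h) = extQuotRep c n (k + 1) h := by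
      intro k
      change (conjOp (extEquiv c k)).symm (extRep n (k + 1) (Φ h)) = _
      rw [← hΦ, AlgEquiv.symm_apply_apply]
    apply unop_injective
    refine LinearMap.ext fun x => DFinsupp.ext fun k => ?_
    simp [HSRep, directSumRep, DirectSum.lmap_apply, h1]

/-! ### Normal words in Temperley-Lieb algebras -/

/-- The decreasing word `x - 1, x - 2, …, y`, which is empty if `x ≤ y`. -/
def runWord : ℕ → ℕ → List ℕ
  | 0, _ => []
  | x + 1, y => if y ≤ x then x :: runWord x y else []

theorem runWord_succ {x y : ℕ} (h : y ≤ x) : runWord (x + 1) y = x :: runWord x y := by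
  rw [runWord, if_pos h]

theorem runWord_of_le {x y : ℕ} (h : x ≤ y) : runWord x y = [] := by
  cases x with
  | zero => rfl
  | succ x => rw [runWord, if_neg (by omega)]

theorem runWord_append {x y z : ℕ} (hy : y ≤ z) (hz : z ≤ x) :
    runWord x y = runWord x z ++ runWord z y := by
  induction x, hz using Nat.le_induction with
  | base => rw [runWord_of_le le_rfl, List.nil_append]
  | succ x hz ih => rw [runWord_succ (hy.trans hz), runWord_succ hz, ih, List.cons_append]

theorem runWord_singleton (y : ℕ) : runWord (y + 1) y = [y] := by
  rw [runWord_succ le_rfl, runWord_of_le le_rfl]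

theorem runWord_eq_append_singleton {x y : ℕ} (h : y < x) :
    runWord x y = runWord x (y + 1) ++ [y] := by
  rw [runWord_append (z := y + 1) (by omega) h, runWord_singleton]

theorem mem_runWord {x y i : ℕ} : i ∈ runWord x y ↔ y ≤ i ∧ i < x := by
  induction x with
  | zero => simp [runWord]
  | succ x ih =>
    rw [runWord]
    split_ifs with h
    · rw [List.mem_cons, ih]; omega
    · simp only [List.not_mem_nil, false_iff]; omega

theorem length_runWord (x y : ℕ) : (runWord x y).length = x - y := by
  induction x with
  | zero => simp [runWord]
  | succ x ih =>
    rw [runWord]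
    split_ifs with h
    · rw [List.length_cons, ih]; omega
    · simp only [List.length_nil]; omega

/-- The word consisting of the given runs, the head of the list being the last run. -/
def runsWord : List (ℕ × ℕ) → List ℕ
  | [] => []
  | r :: W => runsWord W ++ runWord r.1 r.2

/-- The runs of a Jones normal form: nonempty, with strictly increasing tops and bottoms. -/
def IsNormal (N : ℕ) : List (ℕ × ℕ) → Prop
  | [] => True
  | r :: W => r.2 < r.1 ∧ r.1 ≤ N ∧ (∀ s ∈ W, s.1 < r.1 ∧ s.2 < r.2) ∧ IsNormal N W

theorem lt_of_mem_runsWord {N : ℕ} {W : List (ℕ × ℕ)} (hW : IsNormal N W) :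
    ∀ i ∈ runsWord W, i < N := by
  induction W with
  | nil => simp [runsWord]
  | cons r W ih =>
    obtain ⟨-, h2, -, h4⟩ := hW
    intro i hi
    rw [runsWord, List.mem_append, mem_runWord] at hi
    rcases hi with hi | hi
    · exact ih h4 i hi
    · omega

/-! ### Rewriting words with the Temperley-Lieb relations. -/

section Relations

variable {A : Type} [Ring A]

/-- The value of a word in the elements `e i`. -/
def wordVal (e : ℕ → A) (w : List ℕ) : A := (w.map e).prod

theorem wordVal_append (e : ℕ → A) (u w : List ℕ) :
    wordVal e (u ++ w) = wordVal e u * wordVal e w := by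
  rw [wordVal, List.map_append, List.prod_append]; rfl

theorem wordVal_singleton (e : ℕ → A) (i : ℕ) : wordVal e [i] = e i := by
  rw [wordVal, List.map_singleton, List.prod_singleton]

theorem wordVal_nil (e : ℕ → A) : wordVal e [] = 1 := rfl

/-- The Temperley-Lieb relations with loop parameter `0` for the elements `e i`, `i < N`. -/
structure IsTemperleyLieb (N : ℕ) (e : ℕ → A) : Prop where
  sq : ∀ i < N, e i * e i = 0
  adj : ∀ i, i + 1 < N → e i * e (i + 1) * e i = e i
  adj' : ∀ i, i + 1 < N → e (i + 1) * e i * e (i + 1) = e (i + 1)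
  comm : ∀ i j, i + 1 < j → j < N → Commute (e i) (e j)

namespace IsTemperleyLieb

variable {N : ℕ} {e : ℕ → A}

theorem commute_run_of_lt (he : IsTemperleyLieb N e) {i x y : ℕ} (hi : i + 1 < y) (hx : x ≤ N) :
    Commute (e i) (wordVal e (runWord x y)) := by
  refine Commute.list_prod_right _ _ fun a ha => ?_
  obtain ⟨j, hj, rfl⟩ := List.mem_map.mp ha
  rw [mem_runWord] at hj
  exact he.comm i j (by omega) (by omega)

theorem commute_run_of_gt (he : IsTemperleyLieb N e) {i x y : ℕ} (hi : x < i) (hN : i < N) :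
    Commute (e i) (wordVal e (runWord x y)) := by
  refine Commute.list_prod_right _ _ fun a ha => ?_
  obtain ⟨j, hj, rfl⟩ := List.mem_map.mp ha
  rw [mem_runWord] at hj
  exact (he.comm j i (by omega) hN).symm

theorem run_mul_self (he : IsTemperleyLieb N e) {x y : ℕ} (h : y < x) (hx : x ≤ N) :
    wordVal e (runWord x y) * e y = 0 := by
  rw [runWord_eq_append_singleton h, wordVal_append, wordVal_singleton, mul_assoc,
    he.sq y (by omega), mul_zero]

/-- The new letter commutes past `e (i - 1), …, e y`, and then `e (i + 1) * e i * e (i + 1)`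
contracts. The word becomes shorter. -/
theorem run_mul_of_lt (he : IsTemperleyLieb N e) {i x y : ℕ} (hy : y ≤ i)
    (hi : i + 1 < x) (hx : x ≤ N) :
    wordVal e (runWord x y) * e (i + 1) = wordVal e (runWord x (i + 1) ++ runWord i y) := by
  have h1 : runWord x y = runWord x (i + 2) ++ ([i + 1] ++ ([i] ++ runWord i y)) := by
    rw [runWord_append (z := i + 2) (by omega) (by omega),
      runWord_append (x := i + 2) (z := i + 1) (y := y) (by omega) (by omega),
      runWord_append (x := i + 1) (z := i) (y := y) (by omega) (by omega), runWord_singleton,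
      runWord_singleton]
  have h2 : runWord x (i + 1) = runWord x (i + 2) ++ [i + 1] :=
    runWord_eq_append_singleton hi
  rw [h1, h2]
  simp only [wordVal_append, wordVal_singleton]
  rw [mul_assoc, mul_assoc, mul_assoc, ← (he.commute_run_of_gt (x := i) (y := y)
    (Nat.lt_succ_self i) (by omega)).eq, ← mul_assoc (e i), ← mul_assoc (e (i + 1)),
    ← mul_assoc (e (i + 1)), he.adj' i (by omega), mul_assoc]

/-- The last letter `e i` of the first run commutes past `e (x - 1), …, e (i + 2)`, and then `e i *
e (i + 1) * e i` contracts. -/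
theorem run_mul_run (he : IsTemperleyLieb N e) {i x x' : ℕ} (h : i < x')
    (h' : x' < x) (hx : x ≤ N) :
    wordVal e (runWord x' i) * (wordVal e (runWord x (i + 1)) * e i) =
      wordVal e (runWord x' (i + 1) ++ (runWord x (i + 2) ++ [i])) := by
  rw [runWord_eq_append_singleton h, runWord_eq_append_singleton (x := x) (y := i + 1) (by omega)]
  simp only [wordVal_append, wordVal_singleton]
  rw [mul_assoc, mul_assoc, ← mul_assoc (e i), (he.commute_run_of_lt (i := i) (y := i + 2)
    (by omega) hx).eq, mul_assoc (wordVal e (runWord x (i + 2))), ← mul_assoc (e i),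
    he.adj i (by omega)]

/-- Multiplication of a normal word by a generator. -/
theorem normal_mul (he : IsTemperleyLieb N e) (W : List (ℕ × ℕ))
    (hW : IsNormal N W) (i : ℕ) (hi : i < N) :
    wordVal e (runsWord W) * e i = 0 ∨
    (∃ u : List ℕ, u.length ≤ (runsWord W).length ∧ (∀ j ∈ u, j < N) ∧
      wordVal e u = wordVal e (runsWord W) * e i) ∨
    (∃ V, IsNormal N V ∧ (runsWord V).length = (runsWord W).length + 1 ∧
      wordVal e (runsWord V) = wordVal e (runsWord W) * e i ∧
      (∀ x, i < x → (∀ s ∈ W, s.1 ≤ x) → ∀ s ∈ V, s.1 ≤ x) ∧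
      ∀ y, i ≤ y → (∀ s ∈ W, s.2 ≤ y) → ∀ s ∈ V, s.2 ≤ y) := by
  induction W with
  | nil =>
    refine Or.inr (Or.inr ⟨[(i + 1, i)], ?_, ?_, ?_, ?_, ?_⟩)
    · exact ⟨Nat.lt_succ_self i, hi, by simp, trivial⟩
    · simp [runsWord, runWord_singleton]
    · simp [runsWord, runWord_singleton, wordVal]
    · intro x hx _ s hs
      rw [List.mem_singleton] at hs
      subst hs
      exact hx
    · intro y hy _ s hs
      rw [List.mem_singleton] at hs
      subst hs
      exact hy
  | cons r W ih =>
    obtain ⟨x, y⟩ := r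
    have hW' := hW
    obtain ⟨hyx, hxN, hlt, hWn⟩ := hW'
    dsimp only at hyx hxN hlt
    have hletters := lt_of_mem_runsWord hWn
    rw [runsWord, wordVal_append, mul_assoc, List.length_append, length_runWord]
    rcases Nat.lt_or_ge i x with hix | hix
    · rcases lt_trichotomy i y with hiy | rfl | hiy
      · rcases Nat.lt_or_ge (i + 1) y with hiy' | hiy'
        · -- the generator commutes with the last run
          have hcomm : wordVal e (runsWord W) * (wordVal e (runWord x y) * e i) =
              wordVal e (runsWord W) * e i * wordVal e (runWord x y) := by
            rw [← (he.commute_run_of_lt hiy' hxN).eq, mul_assoc]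
          rw [hcomm]
          rcases ih hWn with h | ⟨u, hu1, hu2, hu3⟩ | ⟨V, hV1, hV2, hV3, hV4, hV5⟩
          · left
            rw [h, zero_mul]
          · right; left
            refine ⟨u ++ runWord x y, ?_, ?_, ?_⟩
            · rw [List.length_append, length_runWord]; omega
            · intro j hj
              rcases List.mem_append.mp hj with hj | hj
              · exact hu2 j hj
              · rw [mem_runWord] at hj; omega
            · rw [wordVal_append, hu3]
          · right; right
            refine ⟨(x, y) :: V, ⟨hyx, hxN, fun s hs => ⟨?_, ?_⟩, hV1⟩, ?_, ?_, ?_, ?_⟩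
            -- The bounds carried through the induction ensure that the tops and bottoms in `V` stay
            -- below those of the run `(x, y)`.
            · have h := hV4 (x - 1) (by omega)
                (fun s hs => by have := (hlt s hs).1; omega) s hs
              dsimp only
              omega
            · have h := hV5 (y - 1) (by omega)
                (fun s hs => by have := (hlt s hs).2; omega) s hs
              dsimp only
              omega
            · rw [runsWord, List.length_append, length_runWord, hV2]; omega
            · rw [runsWord, wordVal_append, hV3]
            · intro z hz hs s hsV
              rcases List.mem_cons.mp hsV with rfl | hsV
              · exact hs _ List.mem_cons_self
              · exact hV4 z hz (fun t ht => hs t (List.mem_cons_of_mem _ ht)) s hsV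
            · intro z hz hs s hsV
              rcases List.mem_cons.mp hsV with rfl | hsV
              · exact hs _ List.mem_cons_self
              · exact hV5 z hz (fun t ht => hs t (List.mem_cons_of_mem _ ht)) s hsV
        · -- the generator extends the last run
          obtain rfl : y = i + 1 := by omega
          by_cases hW2 : ∀ s ∈ W, s.2 < i
          · right; right
            refine ⟨(x, i) :: W, ⟨hix, hxN, fun s hs => ⟨(hlt s hs).1, hW2 s hs⟩, hWn⟩,
              ?_, ?_, ?_, ?_⟩
            · rw [runsWord, List.length_append, length_runWord]
              dsimp only
              omega
            · rw [runsWord, wordVal_append, runWord_eq_append_singleton hix, wordVal_append,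
                wordVal_singleton]
            · intro z hz hs s hsV
              rcases List.mem_cons.mp hsV with rfl | hsV
              · exact hs (x, i + 1) List.mem_cons_self
              · exact hs _ (List.mem_cons_of_mem _ hsV)
            · intro z hz hs s hsV
              rcases List.mem_cons.mp hsV with rfl | hsV
              · exact hz
              · exact hs _ (List.mem_cons_of_mem _ hsV)
          · right; left
            cases W with
            | nil => exact absurd (by simp) hW2
            | cons r' W =>
              obtain ⟨x', y'⟩ := r'
              obtain ⟨hyx', -, hlt', -⟩ := hWn
              dsimp only at hyx' hlt'
              have hy' := (hlt (x', y') List.mem_cons_self)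
              dsimp only at hy'
              -- All bottoms of the earlier runs are at most `i`, and the one at the head is the
              -- largest. If it were smaller than `i`, the extension would be normal.
              obtain rfl : y' = i := by
                by_contra hne
                refine hW2 fun s hs => ?_
                rcases List.mem_cons.mp hs with rfl | hs
                · dsimp only; omega
                · have := (hlt' s hs).2; omega
              refine ⟨runsWord W ++ (runWord x' (y' + 1) ++ (runWord x (y' + 2) ++ [y'])),
                ?_, ?_, ?_⟩
              · simp only [runsWord, List.length_append, length_runWord, List.length_singleton]
                omega
              · intro j hj
                simp only [List.mem_append, mem_runWord, List.mem_singleton] at hj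
                rcases hj with hj | hj | hj | hj
                · exact hletters j (by rw [runsWord]; exact List.mem_append_left _ hj)
                · omega
                · omega
                · omega
              · rw [wordVal_append, ← he.run_mul_run hyx' hy'.1 hxN, runsWord, wordVal_append,
                  mul_assoc]
      · left
        rw [he.run_mul_self hyx hxN, mul_zero]
      · right; left
        obtain ⟨i, rfl⟩ : ∃ j, i = j + 1 := ⟨i - 1, by omega⟩
        refine ⟨runsWord W ++ (runWord x (i + 1) ++ runWord i y), ?_, ?_, ?_⟩
        · simp only [List.length_append, length_runWord]
          omega
        · intro j hj
          simp only [List.mem_append, mem_runWord] at hj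
          rcases hj with hj | hj | hj
          · exact hletters j hj
          · omega
          · omega
        · rw [wordVal_append, he.run_mul_of_lt (by omega) hix hxN]
    -- Here `y < x ≤ i`, so the letter `i` forms a new last run.
    · right; right
      refine ⟨(i + 1, i) :: (x, y) :: W, ⟨Nat.lt_succ_self i, hi, fun s hs => ?_, hW⟩,
        ?_, ?_, ?_, ?_⟩
      · rcases List.mem_cons.mp hs with rfl | hs
        · dsimp only; omega
        · have := hlt s hs
          dsimp only
          omega
      · simp only [runsWord, List.length_append, length_runWord]
        omega
      · simp only [runsWord, wordVal_append, runWord_singleton, wordVal_singleton, mul_assoc]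
      · intro z hz hs s hsV
        rcases List.mem_cons.mp hsV with rfl | hsV
        · exact hz
        · exact hs _ hsV
      · intro z hz hs s hsV
        rcases List.mem_cons.mp hsV with rfl | hsV
        · exact hz
        · exact hs _ hsV

/-- Induction on the length, one letter at a time. The length bound on the spanning set matters:
`normal_mul` may return a word that is not normal, but it is short enough for the induction
hypothesis. -/
theorem wordVal_mem_span_normal_le [Algebra ℂ A] (he : IsTemperleyLieb N e) (l : ℕ) :
    ∀ u : List ℕ, u.length ≤ l → (∀ j ∈ u, j < N) →
    wordVal e u ∈ Submodule.span ℂ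
      ((fun W => wordVal e (runsWord W)) '' {W | IsNormal N W ∧ (runsWord W).length ≤ l}) := by
  induction l with
  | zero =>
    intro u hu _
    obtain rfl := List.length_eq_zero_iff.mp (Nat.le_zero.mp hu)
    exact Submodule.subset_span ⟨[], ⟨trivial, le_rfl⟩, rfl⟩
  | succ l ih =>
    intro u hu hN
    have hmono : Submodule.span ℂ
        ((fun W => wordVal e (runsWord W)) '' {W | IsNormal N W ∧ (runsWord W).length ≤ l}) ≤
        Submodule.span ℂ ((fun W => wordVal e (runsWord W)) ''
          {W | IsNormal N W ∧ (runsWord W).length ≤ l + 1}) :=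
      Submodule.span_mono (Set.image_mono fun W hW => ⟨hW.1, hW.2.trans (Nat.le_succ l)⟩)
    rcases List.eq_nil_or_concat u with rfl | ⟨u, i, hui⟩
    · exact Submodule.subset_span ⟨[], ⟨trivial, Nat.zero_le _⟩, rfl⟩
    · rw [List.concat_eq_append] at hui
      subst hui
      rw [List.length_append, List.length_singleton] at hu
      have hi : i < N := hN i (by simp)
      have h := ih u (by omega) fun j hj => hN j (List.mem_append_left _ hj)
      rw [wordVal_append, wordVal_singleton]
      generalize wordVal e u = a at h
      induction h using Submodule.span_induction with
      | mem a ha =>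
        obtain ⟨W, ⟨hW, hWl⟩, rfl⟩ := ha
        rcases he.normal_mul W hW i hi with h | ⟨v, hv1, hv2, hv3⟩ | ⟨V, hV1, hV2, hV3, -, -⟩
        · dsimp only
          rw [h]
          exact zero_mem _
        · dsimp only
          rw [← hv3]
          exact hmono (ih v (hv1.trans hWl) hv2)
        · dsimp only
          rw [← hV3]
          exact Submodule.subset_span ⟨V, ⟨hV1, by omega⟩, rfl⟩
      | zero => rw [zero_mul]; exact zero_mem _
      | add a b _ _ ha hb => rw [add_mul]; exact add_mem ha hb
      | smul r a _ ha => rw [smul_mul_assoc]; exact Submodule.smul_mem _ r ha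

theorem wordVal_mem_span_normal [Algebra ℂ A] (he : IsTemperleyLieb N e) (u : List ℕ)
    (hu : ∀ j ∈ u, j < N) :
    wordVal e u ∈ Submodule.span ℂ ((fun W => wordVal e (runsWord W)) '' {W | IsNormal N W}) :=
  Submodule.span_mono (Set.image_mono fun _ hW => hW.1)
    (he.wordVal_mem_span_normal_le u.length u le_rfl hu)

end IsTemperleyLieb

end Relations

/-! ### Temperley-Lieb generators inside the algebra of nondecreasing functions -/

/-- The function `i + 1 ↦ i`, and the identity if `i` is out of range. -/
def lowerFun (n i : ℕ) : NDF n := if h : i < n - 1 then piFun ⟨i, h⟩ else 1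

/-- The function `i ↦ i + 1`, and the identity if `i` is out of range. -/
def raiseFun (n i : ℕ) : NDF n := if h : i < n - 1 then piBarFun ⟨i, h⟩ else 1

section Functions

variable {n : ℕ}

theorem NDF_ext_val {f g : NDF n} (h : ∀ x, (f.unop x : ℕ) = g.unop x) : f = g :=
  NDF_ext fun x => Fin.ext (h x)

theorem lowerFun_val {i : ℕ} (hi : i < n - 1) (x : Fin n) :
    ((lowerFun n i).unop x : ℕ) = if (x : ℕ) = i + 1 then i else x := by
  rw [lowerFun, dif_pos hi, piFun_apply, apply_ite Fin.val]
  exact if_congr Fin.ext_iff rfl rfl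

theorem raiseFun_val {i : ℕ} (hi : i < n - 1) (x : Fin n) :
    ((raiseFun n i).unop x : ℕ) = if (x : ℕ) = i then i + 1 else x := by
  rw [raiseFun, dif_pos hi, piBarFun_apply, apply_ite Fin.val]
  exact if_congr Fin.ext_iff rfl rfl

/-- The image of the Temperley-Lieb generator, up to a scalar. -/
noncomputable def diffFun (n i : ℕ) : MonoidAlgebra ℂ (NDF n) :=
  ofNDF (lowerFun n i) - ofNDF (raiseFun n i)

/-- Each of the four products equals its right-hand factor, so the terms cancel. -/
theorem diffFun_sq {i : ℕ} (hi : i < n - 1) : diffFun n i * diffFun n i = 0 := by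
  have h1 : lowerFun n i * lowerFun n i = lowerFun n i := NDF_ext_val fun x => by
    simp only [NDF_mul_apply, lowerFun_val hi]; split_ifs <;> omega
  have h2 : lowerFun n i * raiseFun n i = raiseFun n i := NDF_ext_val fun x => by
    simp only [NDF_mul_apply, lowerFun_val hi, raiseFun_val hi]; split_ifs <;> omega
  have h3 : raiseFun n i * lowerFun n i = lowerFun n i := NDF_ext_val fun x => by
    simp only [NDF_mul_apply, lowerFun_val hi, raiseFun_val hi]; split_ifs <;> omega
  have h4 : raiseFun n i * raiseFun n i = raiseFun n i := NDF_ext_val fun x => by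
    simp only [NDF_mul_apply, raiseFun_val hi]; split_ifs <;> omega
  simp only [diffFun, ofNDF, sub_mul, mul_sub, ← map_mul, h1, h2, h3, h4]
  abel

theorem diffFun_commute {i j : ℕ} (hij : i + 1 < j) (hj : j < n - 1) :
    Commute (diffFun n i) (diffFun n j) := by
  have hi : i < n - 1 := by omega
  have h1 : Commute (lowerFun n i) (lowerFun n j) := NDF_ext_val fun x => by
    simp only [NDF_mul_apply, lowerFun_val hi, lowerFun_val hj]; split_ifs <;> omega
  have h2 : Commute (lowerFun n i) (raiseFun n j) := NDF_ext_val fun x => by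
    simp only [NDF_mul_apply, lowerFun_val hi, raiseFun_val hj]; split_ifs <;> omega
  have h3 : Commute (raiseFun n i) (lowerFun n j) := NDF_ext_val fun x => by
    simp only [NDF_mul_apply, raiseFun_val hi, lowerFun_val hj]; split_ifs <;> omega
  have h4 : Commute (raiseFun n i) (raiseFun n j) := NDF_ext_val fun x => by
    simp only [NDF_mul_apply, raiseFun_val hi, raiseFun_val hj]; split_ifs <;> omega
  exact ((h1.map (MonoidAlgebra.of ℂ _)).sub_right (h2.map _)).sub_left
    ((h3.map (MonoidAlgebra.of ℂ _)).sub_right (h4.map _))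

/-- Of the eight triple products six cancel in pairs. The two left are those with `pᵢ p̄ᵢ₊₁` in
front, which collapse to `pᵢ` and `p̄ᵢ` with the wrong sign; a scalar of square `-1` repairs it. -/
theorem diffFun_adj {i : ℕ} (hj : i + 1 < n - 1) :
    diffFun n i * diffFun n (i + 1) * diffFun n i = -diffFun n i := by
  have hi : i < n - 1 := by omega
  have h1 : raiseFun n i * lowerFun n (i + 1) * lowerFun n i =
      lowerFun n i * lowerFun n (i + 1) * lowerFun n i := NDF_ext_val fun x => by
    simp only [NDF_mul_apply, raiseFun_val hi, lowerFun_val hi, lowerFun_val hj]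
    split_ifs <;> omega
  have h2 : raiseFun n i * lowerFun n (i + 1) * raiseFun n i =
      lowerFun n i * lowerFun n (i + 1) * raiseFun n i := NDF_ext_val fun x => by
    simp only [NDF_mul_apply, raiseFun_val hi, lowerFun_val hi, lowerFun_val hj]
    split_ifs <;> omega
  have h3 : lowerFun n i * raiseFun n (i + 1) * lowerFun n i = lowerFun n i :=
    NDF_ext_val fun x => by
      simp only [NDF_mul_apply, raiseFun_val hj, lowerFun_val hi]
      split_ifs <;> omega
  have h4 : lowerFun n i * raiseFun n (i + 1) * raiseFun n i = raiseFun n i :=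
    NDF_ext_val fun x => by
      simp only [NDF_mul_apply, raiseFun_val hj, raiseFun_val hi, lowerFun_val hi]
      split_ifs <;> omega
  have h5 : raiseFun n i * raiseFun n (i + 1) * raiseFun n i =
      raiseFun n i * raiseFun n (i + 1) * lowerFun n i := NDF_ext_val fun x => by
    simp only [NDF_mul_apply, raiseFun_val hj, raiseFun_val hi, lowerFun_val hi]
    split_ifs <;> omega
  simp only [diffFun, ofNDF, sub_mul, mul_sub, ← map_mul, h1, h2, h3, h4, h5]
  abel

theorem diffFun_adj' {i : ℕ} (hj : i + 1 < n - 1) :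
    diffFun n (i + 1) * diffFun n i * diffFun n (i + 1) = -diffFun n (i + 1) := by
  have hi : i < n - 1 := by omega
  have h1 : raiseFun n (i + 1) * raiseFun n i * raiseFun n (i + 1) =
      lowerFun n (i + 1) * raiseFun n i * raiseFun n (i + 1) := NDF_ext_val fun x => by
    simp only [NDF_mul_apply, raiseFun_val hi, raiseFun_val hj, lowerFun_val hj]
    split_ifs <;> omega
  have h2 : raiseFun n (i + 1) * raiseFun n i * lowerFun n (i + 1) =
      lowerFun n (i + 1) * raiseFun n i * lowerFun n (i + 1) := NDF_ext_val fun x => by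
    simp only [NDF_mul_apply, raiseFun_val hi, raiseFun_val hj, lowerFun_val hj]
    split_ifs <;> omega
  have h3 : raiseFun n (i + 1) * lowerFun n i * raiseFun n (i + 1) = raiseFun n (i + 1) :=
    NDF_ext_val fun x => by
      simp only [NDF_mul_apply, raiseFun_val hj, lowerFun_val hi]
      split_ifs <;> omega
  have h4 : raiseFun n (i + 1) * lowerFun n i * lowerFun n (i + 1) = lowerFun n (i + 1) :=
    NDF_ext_val fun x => by
      simp only [NDF_mul_apply, raiseFun_val hj, lowerFun_val hj, lowerFun_val hi]
      split_ifs <;> omega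
  have h5 : lowerFun n (i + 1) * lowerFun n i * raiseFun n (i + 1) =
      lowerFun n (i + 1) * lowerFun n i * lowerFun n (i + 1) := NDF_ext_val fun x => by
    simp only [NDF_mul_apply, raiseFun_val hj, lowerFun_val hj, lowerFun_val hi]
    split_ifs <;> omega
  simp only [diffFun, ofNDF, sub_mul, mul_sub, ← map_mul, h1, h2, h3, h4, h5]
  abel

theorem isTemperleyLieb_smul_diffFun (n : ℕ) {s : ℂ} (hs : s * s = -1) :
    IsTemperleyLieb (n - 1) fun i => s • diffFun n i where
  sq i hi := by
    rw [smul_mul_smul_comm, diffFun_sq hi, smul_zero]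
  adj i hi := by
    rw [smul_mul_smul_comm, smul_mul_smul_comm, diffFun_adj hi, hs]
    module
  adj' i hi := by
    rw [smul_mul_smul_comm, smul_mul_smul_comm, diffFun_adj' hi, hs]
    module
  comm i j hij hj := ((diffFun_commute hij hj).smul_right s).smul_left s

/-! ### Leading functions of normal words -/

/-- The function obtained by composing the functions `i + 1 ↦ i` along a word. -/
def lowerWord (n : ℕ) (w : List ℕ) : NDF n := (w.map (lowerFun n)).prod

theorem lowerWord_append (u w : List ℕ) :
    lowerWord n (u ++ w) = lowerWord n u * lowerWord n w := by
  rw [lowerWord, List.map_append, List.prod_append]; rfl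

/-- The leftmost letter acts first, so `x` is pushed to `x - 1`, then to `x - 2`, and so on,
gathering up the interval on the way down to `y`. -/
theorem lowerWord_run_val {x y : ℕ} (hy : y ≤ x) (hx : x ≤ n - 1) (v : Fin n) :
    ((lowerWord n (runWord x y)).unop v : ℕ) = if y ≤ v ∧ (v : ℕ) ≤ x then y else v := by
  induction x, hy using Nat.le_induction generalizing v with
  | base =>
    rw [runWord_of_le le_rfl]
    change (v : ℕ) = _
    split_ifs <;> omega
  | succ x hy ih =>
    rw [runWord_succ hy, lowerWord, List.map_cons, List.prod_cons, NDF_mul_apply]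
    refine (ih (by omega) _).trans ?_
    rw [lowerFun_val (by omega)]
    split_ifs <;> omega

theorem mul_mem_span_of {M : Type} [Monoid M] {a b : MonoidAlgebra ℂ M} {T U V : Set M}
    (ha : a ∈ Submodule.span ℂ (MonoidAlgebra.of ℂ M '' T))
    (hb : b ∈ Submodule.span ℂ (MonoidAlgebra.of ℂ M '' U))
    (h : ∀ t ∈ T, ∀ u ∈ U, t * u ∈ V) :
    a * b ∈ Submodule.span ℂ (MonoidAlgebra.of ℂ M '' V) := by
  have h1 := Submodule.mul_mem_mul ha hb
  rw [Submodule.span_mul_span] at h1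
  refine Submodule.span_mono ?_ h1
  rintro _ ⟨_, ⟨t, ht, rfl⟩, _, ⟨u, hu, rfl⟩, rfl⟩
  exact ⟨t * u, h t ht u hu, map_mul _ _ _⟩

/-- Leading terms multiply, provided that the three kinds of mixed products fall into the new tail
`V`. -/
theorem mul_sub_of_mem_span {M : Type} [Monoid M] {a b : MonoidAlgebra ℂ M} {f r : M}
    {T U V : Set M}
    (ha : a - MonoidAlgebra.of ℂ M f ∈ Submodule.span ℂ (MonoidAlgebra.of ℂ M '' T))
    (hb : b - MonoidAlgebra.of ℂ M r ∈ Submodule.span ℂ (MonoidAlgebra.of ℂ M '' U))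
    (hfU : ∀ u ∈ U, f * u ∈ V) (hT : ∀ t ∈ T, t * r ∈ V ∧ ∀ u ∈ U, t * u ∈ V) :
    a * b - MonoidAlgebra.of ℂ M (f * r) ∈ Submodule.span ℂ (MonoidAlgebra.of ℂ M '' V) := by
  have hself : ∀ m : M, MonoidAlgebra.of ℂ M m ∈
      Submodule.span ℂ (MonoidAlgebra.of ℂ M '' {m}) := fun m =>
    Submodule.subset_span ⟨m, rfl, rfl⟩
  have h : a * b - MonoidAlgebra.of ℂ M (f * r) =
      (a - MonoidAlgebra.of ℂ M f) * (b - MonoidAlgebra.of ℂ M r) +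
      MonoidAlgebra.of ℂ M f * (b - MonoidAlgebra.of ℂ M r) +
      (a - MonoidAlgebra.of ℂ M f) * MonoidAlgebra.of ℂ M r := by
    rw [map_mul]; noncomm_ring
  rw [h]
  refine add_mem (add_mem (mul_mem_span_of ha hb fun t ht => (hT t ht).2) ?_) ?_
  · exact mul_mem_span_of (hself f) hb fun t ht u hu => by
      rw [Set.mem_singleton_iff.mp ht]; exact hfU u hu
  · exact mul_mem_span_of ha (hself r) fun t ht u hu => by
      rw [Set.mem_singleton_iff.mp hu]; exact (hT t ht).1

/-- Functions that occur in the expansion of a run besides the leading one. -/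
def runTail (n x y : ℕ) : Set (NDF n) :=
  {h | (∀ v : Fin n, (v : ℕ) < y → (h.unop v : ℕ) = v) ∧
    (∀ v : Fin n, y ≤ v → y ≤ (h.unop v : ℕ)) ∧ (∀ v : Fin n, x < v → (h.unop v : ℕ) = v) ∧
    ∀ v : Fin n, (v : ℕ) = x → y < (h.unop v : ℕ)}

/-- The leading function carries `x` down to `y` step by step. The first letter at which `p̄` is
chosen instead of `p` stops this descent, and the later letters no longer reach the point, so it
stays strictly above `y`. -/
theorem wordVal_run_sub_mem {x y : ℕ} (hy : y ≤ x) (hx : x ≤ n - 1) :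
    wordVal (diffFun n) (runWord x y) - ofNDF (lowerWord n (runWord x y)) ∈
      Submodule.span ℂ (MonoidAlgebra.of ℂ (NDF n) '' runTail n x y) := by
  induction x, hy using Nat.le_induction with
  | base =>
    rw [runWord_of_le le_rfl, wordVal_nil, lowerWord, List.map_nil, List.prod_nil, ofNDF, map_one,
      sub_self]
    exact zero_mem _
  | succ x hy ih =>
    have hx' : x < n - 1 := by omega
    have hP := lowerFun_val hx'
    have hR := raiseFun_val hx'
    have hr := lowerWord_run_val hy hx'.le
    rw [runWord_succ hy]
    have ha : diffFun n x - ofNDF (lowerFun n x) ∈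
        Submodule.span ℂ (MonoidAlgebra.of ℂ (NDF n) '' {raiseFun n x}) := by
      rw [diffFun, sub_sub_cancel_left]
      exact neg_mem (Submodule.subset_span ⟨_, rfl, rfl⟩)
    refine mul_sub_of_mem_span ha (ih hx'.le) ?_ ?_
    · rintro u ⟨h1, h2, h3, h4⟩
      refine ⟨fun v hv => ?_, fun v hv => ?_, fun v hv => ?_, fun v hv => ?_⟩ <;>
        rw [NDF_mul_apply] <;> have hPv := hP v
      · rw [if_neg (by omega)] at hPv
        rw [h1 _ (by omega), hPv]
      · exact h2 _ (by split_ifs at hPv <;> omega)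
      · rw [if_neg (by omega)] at hPv
        rw [h3 _ (by omega), hPv]
      · rw [if_pos hv] at hPv
        exact h4 _ hPv
    · rintro _ rfl
      refine ⟨⟨fun v hv => ?_, fun v hv => ?_, fun v hv => ?_, fun v hv => ?_⟩, ?_⟩
      · have hRv := hR v
        rw [NDF_mul_apply]
        refine (hr _).trans ?_
        split_ifs at hRv ⊢ <;> omega
      · have hRv := hR v
        rw [NDF_mul_apply]
        refine le_of_le_of_eq ?_ (hr _).symm
        split_ifs at hRv ⊢ <;> omega
      · have hRv := hR v
        rw [NDF_mul_apply]
        refine (hr _).trans ?_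
        split_ifs at hRv ⊢ <;> omega
      · have hRv := hR v
        rw [NDF_mul_apply]
        refine lt_of_lt_of_eq ?_ (hr _).symm
        split_ifs at hRv ⊢ <;> omega
      · rintro u ⟨h1, h2, h3, h4⟩
        refine ⟨fun v hv => ?_, fun v hv => ?_, fun v hv => ?_, fun v hv => ?_⟩ <;>
          rw [NDF_mul_apply] <;> have hRv := hR v
        · rw [if_neg (by omega)] at hRv
          rw [h1 _ (by omega), hRv]
        · exact h2 _ (by split_ifs at hRv <;> omega)
        · rw [if_neg (by omega)] at hRv
          rw [h3 _ (by omega), hRv]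
        · rw [if_neg (by omega)] at hRv
          rw [h3 _ (by omega), hRv]
          omega

theorem lowerWord_runs_of_gt {W : List (ℕ × ℕ)} (hW : IsNormal (n - 1) W) (v : Fin n)
    (hv : ∀ s ∈ W, s.1 < v) : ((lowerWord n (runsWord W)).unop v : ℕ) = v := by
  induction W with
  | nil => rfl
  | cons r W ih =>
    have hrv := hv r List.mem_cons_self
    rw [runsWord, lowerWord_append, NDF_mul_apply]
    refine (lowerWord_run_val hW.1.le hW.2.1 _).trans ?_
    rw [ih hW.2.2.2 fun s hs => hv s (List.mem_cons_of_mem _ hs), if_neg (by omega)]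

theorem lowerWord_runs_cases {W : List (ℕ × ℕ)} (hW : IsNormal (n - 1) W) (v : Fin n) :
    ((lowerWord n (runsWord W)).unop v : ℕ) = v ∨
      ∃ s ∈ W, ((lowerWord n (runsWord W)).unop v : ℕ) ≤ s.2 := by
  induction W with
  | nil => exact Or.inl rfl
  | cons r W ih =>
    have hr := lowerWord_run_val hW.1.le hW.2.1 ((lowerWord n (runsWord W)).unop v)
    rw [runsWord, lowerWord_append, NDF_mul_apply]
    rcases ih hW.2.2.2 with h | ⟨s, hs, h⟩
    · rw [h] at hr
      split_ifs at hr
      · exact Or.inr ⟨r, List.mem_cons_self, hr.le⟩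
      · exact Or.inl hr
    · refine Or.inr ⟨s, List.mem_cons_of_mem _ hs, hr.trans_le ?_⟩
      have := (hW.2.2.1 s hs).2
      split_ifs <;> omega

/-- Functions that occur in the expansion of a normal word besides the leading one. -/
def runsTail (n : ℕ) (W : List (ℕ × ℕ)) : Set (NDF n) :=
  {g | (∀ v, (lowerWord n (runsWord W)).unop v ≤ g.unop v) ∧
    ∃ z, (lowerWord n (runsWord W)).unop z < g.unop z ∧
      ∃ s ∈ W, ((lowerWord n (runsWord W)).unop z : ℕ) ≤ s.2}

/-- A strict inequality with the leading function must survive all later runs. It does because the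
leading value at the witness is at most some bottom, hence below the bottoms of the later runs,
which fix such points. -/
theorem wordVal_runs_sub_mem {W : List (ℕ × ℕ)} (hW : IsNormal (n - 1) W) :
    wordVal (diffFun n) (runsWord W) - ofNDF (lowerWord n (runsWord W)) ∈
      Submodule.span ℂ (MonoidAlgebra.of ℂ (NDF n) '' runsTail n W) := by
  induction W with
  | nil =>
    rw [runsWord, wordVal_nil, lowerWord, List.map_nil, List.prod_nil, ofNDF, map_one, sub_self]
    exact zero_mem _
  | cons p W ih =>
    obtain ⟨x, y⟩ := p
    obtain ⟨hyx, hx, hlt, hWn⟩ := hW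
    dsimp only at hyx hx hlt
    set f := lowerWord n (runsWord W) with hf
    set r := lowerWord n (runWord x y) with hrdef
    have hr : ∀ v, (r.unop v : ℕ) = if y ≤ v ∧ (v : ℕ) ≤ x then y else v :=
      lowerWord_run_val hyx.le hx
    have hfr : lowerWord n (runsWord ((x, y) :: W)) = f * r := lowerWord_append _ _
    have hxn : x < n := by omega
    have hfx : ((f.unop ⟨x, hxn⟩ : Fin n) : ℕ) = x :=
      lowerWord_runs_of_gt hWn ⟨x, hxn⟩ fun s hs => (hlt s hs).1
    have hle : ∀ u ∈ runTail n x y, ∀ v, (r.unop v : ℕ) ≤ u.unop v := by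
      rintro u ⟨h1, h2, h3, -⟩ v
      rw [hr]
      split_ifs with h
      · exact h2 v h.1
      · rcases Nat.lt_or_ge v y with hv | hv
        · exact (h1 v hv).ge
        · exact (h3 v (by omega)).ge
    -- Stated for a general `u` so as to cover both the leading function `r` of the last run and the
    -- members of its tail.
    have key : ∀ u : NDF n, (∀ v : Fin n, (v : ℕ) < y → (u.unop v : ℕ) = v) →
        (∀ v : Fin n, y ≤ v → y ≤ (u.unop v : ℕ)) → (∀ v, (r.unop v : ℕ) ≤ u.unop v) →
        ∀ g ∈ runsTail n W, g * u ∈ runsTail n ((x, y) :: W) := by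
      rintro u h1 h2 h3 g ⟨hg, z, hz, s, hs, hzs⟩
      have hz' : ((f.unop z : Fin n) : ℕ) < g.unop z := hz
      have hzy : ((f.unop z : Fin n) : ℕ) < y := lt_of_le_of_lt hzs (hlt s hs).2
      have hrz : ((r.unop (f.unop z) : Fin n) : ℕ) = f.unop z := by
        rw [hr, if_neg (by omega)]
      refine ⟨fun v => ?_, z, ?_, s, List.mem_cons_of_mem _ hs, ?_⟩
      · rw [hfr]
        exact le_trans (r.unop.monotone (hg v)) (h3 _)
      · rw [hfr, Fin.lt_def, NDF_mul_apply, NDF_mul_apply, hrz]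
        rcases Nat.lt_or_ge (g.unop z) y with h | h
        · rw [h1 _ h]; exact hz
        · exact lt_of_lt_of_le hzy (h2 _ h)
      · rw [hfr, NDF_mul_apply, hrz]
        exact hzs
    rw [hfr, runsWord, wordVal_append]
    refine mul_sub_of_mem_span (ih hWn) (wordVal_run_sub_mem hyx.le hx) ?_ ?_
    -- The witness is `x`: it is fixed by `f`, whose tops are all smaller, then sent to `y` by `r`
    -- but strictly above `y` by `u`.
    · intro u hu
      have hrx : ((r.unop (f.unop ⟨x, hxn⟩) : Fin n) : ℕ) = y := by
        rw [hr, hfx, if_pos ⟨hyx.le, le_rfl⟩]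
      refine ⟨fun v => ?_, ⟨x, hxn⟩, ?_, (x, y), List.mem_cons_self, ?_⟩
      · rw [hfr]
        exact hle u hu _
      · rw [hfr, Fin.lt_def, NDF_mul_apply, NDF_mul_apply, hrx]
        exact hu.2.2.2 _ hfx
      · rw [hfr, NDF_mul_apply, hrx]
    · intro g hg
      refine ⟨key r (fun v hv => ?_) (fun v hv => ?_) (fun v => le_rfl) g hg,
        fun u hu => key u hu.1 hu.2.1 (hle u hu) g hg⟩
      · rw [hr, if_neg (by omega)]
      · rw [hr]
        split_ifs <;> omega

/-- The last run can be read off from the function: its top is the largest point moved and its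
bottom is the value there. The function of the remaining runs is then determined, and one inducts.
-/
theorem lowerWord_runs_injective {V W : List (ℕ × ℕ)} (hV : IsNormal (n - 1) V)
    (hW : IsNormal (n - 1) W) (h : lowerWord n (runsWord V) = lowerWord n (runsWord W)) :
    V = W := by
  have hmoved : ∀ {x y : ℕ} {U : List (ℕ × ℕ)} (hU : IsNormal (n - 1) ((x, y) :: U))
      (v : Fin n), (v : ℕ) = x → ((lowerWord n (runsWord ((x, y) :: U))).unop v : ℕ) = y := by
    intro x y U hU v hv
    rw [runsWord, lowerWord_append, NDF_mul_apply]
    refine (lowerWord_run_val hU.1.le hU.2.1 _).trans ?_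
    rw [lowerWord_runs_of_gt hU.2.2.2 v fun s hs => hv ▸ (hU.2.2.1 s hs).1, hv,
      if_pos ⟨hU.1.le, le_rfl⟩]
  have htop : ∀ {x y : ℕ} {U U' : List (ℕ × ℕ)} (hU : IsNormal (n - 1) ((x, y) :: U))
      (hU' : IsNormal (n - 1) U') (h : lowerWord n (runsWord ((x, y) :: U)) =
        lowerWord n (runsWord U')), ∃ s ∈ U', x ≤ s.1 := by
    intro x y U U' hU hU' h
    by_contra! hlt
    have hy := hU.1
    have hx := hU.2.1
    dsimp only at hx hy
    have h1 := hmoved hU ⟨x, by omega⟩ rfl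
    rw [h, lowerWord_runs_of_gt hU' ⟨x, by omega⟩ hlt] at h1
    dsimp only at h1
    omega
  have hle : ∀ {x y : ℕ} {U : List (ℕ × ℕ)} (hU : IsNormal (n - 1) ((x, y) :: U)),
      ∀ s ∈ (x, y) :: U, s.1 ≤ x := by
    intro x y U hU s hs
    rcases List.mem_cons.mp hs with rfl | hs
    · exact le_rfl
    · exact (hU.2.2.1 s hs).1.le
  induction V generalizing W with
  | nil =>
    cases W with
    | nil => rfl
    | cons r W =>
      obtain ⟨s, hs, -⟩ := htop hW hV h.symm
      exact absurd hs (List.not_mem_nil)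
  | cons p V ih =>
    obtain ⟨x, y⟩ := p
    cases W with
    | nil =>
      obtain ⟨s, hs, -⟩ := htop hV hW h
      exact absurd hs (List.not_mem_nil)
    | cons p' W =>
      obtain ⟨x', y'⟩ := p'
      obtain ⟨s, hs, hxs⟩ := htop hV hW h
      obtain ⟨s', hs', hxs'⟩ := htop hW hV h.symm
      obtain rfl : x = x' := le_antisymm (hxs.trans (hle hW s hs)) (hxs'.trans (hle hV s' hs'))
      have hx := hV.2.1
      have hyx := hV.1
      dsimp only at hx hyx
      have hxn : x < n := by omega
      obtain rfl : y = y' := by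
        rw [← hmoved hV ⟨x, hxn⟩ rfl, h, hmoved hW ⟨x, hxn⟩ rfl]
      -- The earlier runs either fix `v` or send it below `y`, and the last run fixes everything
      -- below `y`. So a final value below `y` comes from `U`, and otherwise `U` fixed `v`.
      have htail : ∀ {U : List (ℕ × ℕ)} (hU : IsNormal (n - 1) ((x, y) :: U)) (v : Fin n),
          ((lowerWord n (runsWord U)).unop v : ℕ) =
            if ((lowerWord n (runsWord ((x, y) :: U))).unop v : ℕ) < y then
              ((lowerWord n (runsWord ((x, y) :: U))).unop v : ℕ) else v := by
        intro U hU v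
        have h1 := lowerWord_run_val hU.1.le hU.2.1 ((lowerWord n (runsWord U)).unop v)
        have h2 : ((lowerWord n (runsWord U)).unop v : ℕ) = v ∨
            ((lowerWord n (runsWord U)).unop v : ℕ) < y := by
          rcases lowerWord_runs_cases hU.2.2.2 v with h2 | ⟨s, hs, h2⟩
          · exact Or.inl h2
          · exact Or.inr (lt_of_le_of_lt h2 (hU.2.2.1 s hs).2)
        have h3 : (lowerWord n (runsWord ((x, y) :: U))).unop v =
            (lowerWord n (runWord x y)).unop ((lowerWord n (runsWord U)).unop v) := by
          rw [runsWord, lowerWord_append, NDF_mul_apply]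
        rw [h3]
        dsimp only at h1
        rw [h1]
        split_ifs <;> omega
      rw [ih hV.2.2.2 hW.2.2.2 (NDF_ext_val fun v => by rw [htail hV, htail hW, h])]

end Functions

/-! ### Linear independence from leading terms. -/

/-- In a vanishing combination choose `i` with nonzero coefficient and `φ (f i)` minimal; at `f i`
only `v i` has a nonzero coefficient. The map `φ` carries the order, here the pointwise order on
functions. -/
theorem linearIndependent_of_leading {ι M P : Type} [Monoid M] [PartialOrder P] {φ : M → P}
    {v : ι → MonoidAlgebra ℂ M} {u : ι → ℂ} {f : ι → M} (hu : ∀ i, u i ≠ 0)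
    (hf : Function.Injective fun i => φ (f i))
    (hv : ∀ i, v i - u i • MonoidAlgebra.of ℂ M (f i) ∈
      Submodule.span ℂ (MonoidAlgebra.of ℂ M '' {g | φ (f i) < φ g})) :
    LinearIndependent ℂ v := by
  classical
  have hcoeff : ∀ i g, ¬ φ (f i) < φ g → (v i).coeff g = if f i = g then u i else 0 := by
    intro i g hg
    have hzero : ∀ a ∈ Submodule.span ℂ (MonoidAlgebra.of ℂ M '' {g | φ (f i) < φ g}),
        a.coeff g = 0 := by
      intro a ha
      induction ha using Submodule.span_induction with
      | mem a ha =>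
        obtain ⟨g', hg', rfl⟩ := ha
        have hne : g' ≠ g := fun h => hg (h ▸ hg')
        simp [MonoidAlgebra.of_apply, hne]
      | zero => rfl
      | add a b _ _ ha hb => simp [ha, hb]
      | smul r a _ ha => simp [ha]
    have h := hzero _ (hv i)
    have h2 : (v i).coeff g = (u i • MonoidAlgebra.of ℂ M (f i)).coeff g := by
      rw [← sub_eq_zero, ← h]; simp
    rw [h2]
    simp [MonoidAlgebra.of_apply, Finsupp.single_apply]
  rw [linearIndependent_iff']
  intro s c hc
  by_contra! hne
  obtain ⟨i₀, hi₀, hci₀⟩ := hne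
  obtain ⟨i, hi⟩ := (s.filter fun i => c i ≠ 0).exists_minimalFor (fun i => φ (f i))
    ⟨i₀, Finset.mem_filter.mpr ⟨hi₀, hci₀⟩⟩
  obtain ⟨his, hci⟩ := Finset.mem_filter.mp hi.1
  have h0 := congrArg (fun a => a.coeff (f i)) hc
  simp only [MonoidAlgebra.coeff_sum, Finsupp.finsetSum_apply, MonoidAlgebra.coeff_zero,
    Finsupp.zero_apply, MonoidAlgebra.coeff_smul, Finsupp.smul_apply, smul_eq_mul] at h0
  rw [Finset.sum_eq_single i] at h0
  · rw [hcoeff i _ (lt_irrefl _), if_pos rfl, mul_eq_zero] at h0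
    exact h0.elim hci (hu i)
  · intro j hj hji
    by_cases hcj : c j = 0
    · rw [hcj, zero_mul]
    · have hlt : ¬ φ (f j) < φ (f i) := fun hlt =>
        (hi.2 (Finset.mem_filter.mpr ⟨hj, hcj⟩) hlt.le).not_gt hlt
      rw [hcoeff j _ hlt, if_neg fun h => hji (hf (congrArg φ h)), mul_zero]
  · exact fun h => absurd his h

/-! ### Faithfulness of the representation of the Temperley-Lieb algebra -/

/-- The generators of the Temperley-Lieb algebra, and `0` if `i` is out of range. -/
noncomputable def tlGen (n i : ℕ) : TemperleyLieb n 0 :=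
  if h : i < n - 1 then TemperleyLieb.e 0 ⟨i, h⟩ else 0

theorem tlGen_of_lt {n i : ℕ} (h : i < n - 1) : tlGen n i = TemperleyLieb.e 0 ⟨i, h⟩ := dif_pos h

theorem TemperleyLieb.e_rel {n : ℕ} {δ : ℂ} {x y : FreeAlgebra ℂ (Fin (n - 1))}
    (h : TLRel n δ x y) :
    RingQuot.mkAlgHom ℂ (TLRel n δ) x = RingQuot.mkAlgHom ℂ (TLRel n δ) y :=
  RingQuot.mkAlgHom_rel ℂ h

theorem isTemperleyLieb_tlGen (n : ℕ) : IsTemperleyLieb (n - 1) (tlGen n) where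
  sq i hi := by
    have h := TemperleyLieb.e_rel (TLRel.sq (δ := 0) (⟨i, hi⟩ : Fin (n - 1)))
    rw [zero_smul, map_zero, map_mul] at h
    rw [tlGen_of_lt hi]
    exact h
  adj i hj := by
    have hi : i < n - 1 := by omega
    have h := TemperleyLieb.e_rel
      (TLRel.adj (δ := 0) (⟨i, hi⟩ : Fin (n - 1)) ⟨i + 1, hj⟩ (Or.inl rfl))
    rw [map_mul, map_mul] at h
    rw [tlGen_of_lt hi, tlGen_of_lt hj]
    exact h
  adj' i hj := by
    have hi : i < n - 1 := by omega
    have h := TemperleyLieb.e_rel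
      (TLRel.adj (δ := 0) (⟨i + 1, hj⟩ : Fin (n - 1)) ⟨i, hi⟩ (Or.inr rfl))
    rw [map_mul, map_mul] at h
    rw [tlGen_of_lt hi, tlGen_of_lt hj]
    exact h
  comm i j hij hj := by
    have hi : i < n - 1 := by omega
    have h := TemperleyLieb.e_rel
      (TLRel.comm (δ := 0) (⟨i, hi⟩ : Fin (n - 1)) ⟨j, hj⟩ hij)
    rw [map_mul, map_mul] at h
    rw [tlGen_of_lt hi, tlGen_of_lt hj]
    exact h

theorem TemperleyLieb.adjoin_e (n : ℕ) (δ : ℂ) :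
    Algebra.adjoin ℂ (Set.range (TemperleyLieb.e (n := n) δ)) = ⊤ := by
  have h : Set.range (TemperleyLieb.e (n := n) δ) =
      RingQuot.mkAlgHom ℂ (TLRel n δ) '' Set.range (FreeAlgebra.ι ℂ) := by
    rw [← Set.range_comp]; rfl
  rw [h, ← AlgHom.map_adjoin, FreeAlgebra.adjoin_range_ι, Algebra.map_top,
    AlgHom.range_eq_top]
  exact RingQuot.mkAlgHom_surjective ℂ _

/-- Words in the generators span the algebra, and each word reduces to normal ones. -/
theorem TemperleyLieb.span_normal (n : ℕ) :
    Submodule.span ℂ (Set.range fun W : {W // IsNormal (n - 1) W} =>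
      wordVal (tlGen n) (runsWord W.1)) = ⊤ := by
  have himage : (Set.range fun W : {W // IsNormal (n - 1) W} =>
      wordVal (tlGen n) (runsWord W.1)) =
      (fun W => wordVal (tlGen n) (runsWord W)) '' {W | IsNormal (n - 1) W} := by
    rw [Set.image_eq_range]; rfl
  rw [himage, eq_top_iff, ← Algebra.top_toSubmodule, ← TemperleyLieb.adjoin_e,
    Algebra.adjoin_eq_span, Submodule.span_le]
  intro x hx
  obtain ⟨l, hl, rfl⟩ := Submonoid.exists_list_of_mem_closure hx
  obtain ⟨l, rfl⟩ : l ∈ Set.range (List.map (TemperleyLieb.e (n := n) 0)) := by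
    rw [Set.range_list_map]; exact hl
  have hword : (l.map (TemperleyLieb.e 0)).prod = wordVal (tlGen n) (l.map Fin.val) := by
    rw [wordVal, List.map_map]
    congr 1
    exact List.map_congr_left fun i _ => (tlGen_of_lt i.isLt).symm
  rw [hword]
  refine (isTemperleyLieb_tlGen n).wordVal_mem_span_normal _ fun j hj => ?_
  obtain ⟨i, -, rfl⟩ := List.mem_map.mp hj
  exact i.isLt

/-- The morphism from the Temperley-Lieb algebra to the algebra of nondecreasing functions. -/
noncomputable def tlHom (n : ℕ) {s : ℂ} (hs : s * s = -1) :
    TemperleyLieb n 0 →ₐ[ℂ] MonoidAlgebra ℂ (NDF n) :=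
  RingQuot.liftAlgHom ℂ ⟨FreeAlgebra.lift ℂ fun i : Fin (n - 1) => s • diffFun n i, by
    have h := isTemperleyLieb_smul_diffFun n hs
    intro x y hxy
    induction hxy with
    | sq i => simpa using h.sq i i.isLt
    | adj i j hij =>
      simp only [map_mul, FreeAlgebra.lift_ι_apply]
      rcases hij with hij | hij
      · have h1 := h.adj i (by omega)
        rwa [hij] at h1
      · have h1 := h.adj' j (by omega)
        rwa [hij] at h1
    | comm i j hij =>
      simp only [map_mul, FreeAlgebra.lift_ι_apply]
      exact h.comm i j hij j.isLt⟩

theorem tlHom_e {n : ℕ} {s : ℂ} (hs : s * s = -1) (i : Fin (n - 1)) :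
    tlHom n hs (TemperleyLieb.e 0 i) = s • diffFun n i := by
  rw [tlHom, TemperleyLieb.e, RingQuot.liftAlgHom_mkAlgHom_apply, FreeAlgebra.lift_ι_apply]

theorem tlHom_wordVal {n : ℕ} {s : ℂ} (hs : s * s = -1) (w : List ℕ) (hw : ∀ i ∈ w, i < n - 1) :
    tlHom n hs (wordVal (tlGen n) w) = s ^ w.length • wordVal (diffFun n) w := by
  induction w with
  | nil => rw [wordVal_nil, wordVal_nil, map_one, List.length_nil, pow_zero, one_smul]
  | cons i w ih =>
    have hi : i < n - 1 := hw i List.mem_cons_self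
    rw [← List.singleton_append, wordVal_append, wordVal_append, map_mul,
      ih fun j hj => hw j (List.mem_cons_of_mem _ hj), wordVal_singleton, wordVal_singleton,
      tlGen_of_lt hi, tlHom_e, smul_mul_smul_comm, List.length_append, List.length_singleton,
      pow_add, pow_one]

/-- The normal words span the source and have linearly independent images, with leading coefficients
the nonzero powers of `s`. -/
theorem tlHom_injective (n : ℕ) {s : ℂ} (hs : s * s = -1) :
    Function.Injective (tlHom n hs) := by
  have hs0 : s ≠ 0 := by
    rintro rfl
    simp at hs
  have hli : LinearIndependent ℂ fun W : {W // IsNormal (n - 1) W} =>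
      tlHom n hs (wordVal (tlGen n) (runsWord W.1)) := by
    refine linearIndependent_of_leading (φ := unop) (u := fun W => s ^ (runsWord W.1).length)
      (f := fun W => lowerWord n (runsWord W.1)) (fun W => pow_ne_zero _ hs0) ?_ fun W => ?_
    · exact fun V W h => Subtype.ext (lowerWord_runs_injective V.2 W.2 (unop_injective h))
    · rw [tlHom_wordVal hs _ (lt_of_mem_runsWord W.2), ← smul_sub]
      refine Submodule.smul_mem _ _ (Submodule.span_mono (Set.image_mono ?_)
        (wordVal_runs_sub_mem W.2))
      rintro g ⟨hg, z, hz, -⟩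
      change unop (lowerWord n (runsWord W.1)) < unop g
      exact lt_of_le_of_ne hg fun h => hz.ne (by rw [h])
  rw [injective_iff_map_eq_zero]
  intro x hx
  have hmem : x ∈ Submodule.span ℂ (Set.range fun W : {W // IsNormal (n - 1) W} =>
      wordVal (tlGen n) (runsWord W.1)) := by
    rw [TemperleyLieb.span_normal]; trivial
  rw [Finsupp.mem_span_range_iff_exists_finsupp] at hmem
  obtain ⟨a, rfl⟩ := hmem
  rw [linearIndependent_iff] at hli
  have ha : a = 0 := by
    refine hli a ?_
    rw [Finsupp.linearCombination_apply, ← hx, Finsupp.sum, Finsupp.sum, map_sum]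
    exact Finset.sum_congr rfl fun W _ => (map_smul _ _ _).symm
  rw [ha, Finsupp.sum_zero_index]

/-- The scalar by which the Temperley-Lieb generators act, up to the functions `p_i`. -/
noncomputable def Side.scalar (c : Side) : ℂ :=
  match c with
  | .first => -Complex.I
  | .last => Complex.I

theorem Side.scalar_mul_self (c : Side) : c.scalar * c.scalar = -1 := by
  cases c <;> simp [Side.scalar]

theorem Side.scalar_smul_diffFun (c : Side) {n : ℕ} (i : Fin (n - 1)) :
    c.scalar • diffFun n i = Complex.I • (ofNDF (c.sortFun i) - ofNDF (c.sortBarFun i)) := by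
  have h1 : lowerFun n i = piFun i := dif_pos i.isLt
  have h2 : raiseFun n i = piBarFun i := dif_pos i.isLt
  rw [diffFun, h1, h2]
  cases c
  · simp only [Side.scalar, Side.sortFun, Side.sortBarFun]
    module
  · rfl

end HeckeSym

/-! ### Assembly of the proposition. -/

open HeckeSym in
theorem proposition6 (n : ℕ) (hn : 1 ≤ n) (c : Side) :
    Function.Injective (NDFRep n) ∧
    (∃ Φ : HS n →ₐ[ℂ] MonoidAlgebra ℂ (NDF n),
      Function.Surjective Φ ∧
      RingHom.ker Φ = RingHom.ker (HSRep c n) ∧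
      (∀ i, Φ (HS.π i) = ofNDF (c.sortFun i)) ∧
      (∀ i, Φ (HS.πbar i) = ofNDF (c.sortBarFun i)) ∧
      (c = Side.last → (hecke n 0).map Φ =
        (MonoidAlgebra.mapDomainAlgHom ℂ ℂ (NDPF n).subtype).range) ∧
      ∃ E : ∀ k : Fin n, ExtQuot c n (k + 1) ≃ₗ[ℂ] ⋀[ℂ]^((k : ℕ) + 1) (Fin n → ℂ),
        (∀ (k : Fin n) (h : HS n) (x : ExtQuot c n (k + 1)),
          E k ((extQuotRep c n (k + 1) h).unop x) = (extRep n (k + 1) (Φ h)).unop (E k x)) ∧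
        (∀ (k : Fin n) (τ : Equiv.Perm (Fin n)) (x : ExtQuot c n (k + 1)),
          E k ((extQuotRep c n (k + 1) (HS.perm τ)).unop x) =
            exteriorPower.map ((k : ℕ) + 1) (linearize (τ⁻¹ : Equiv.Perm (Fin n))) (E k x))) ∧
    (∃ ψ : MonoidAlgebra ℂ (NDPF n) ≃ₐ[ℂ] (hecke n 0).map (HSRep c n),
      ∀ i, (ψ (MonoidAlgebra.of ℂ (NDPF n) (NDPF.π (c.idx i))) : _ᵐᵒᵖ) =
        HSRep c n (HS.π i)) ∧
    (∃ θ : TemperleyLieb n 0 ≃ₐ[ℂ] (hecke n (-1)).map (HSRep c n),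
      ∀ i, (θ (TemperleyLieb.e 0 i) : _ᵐᵒᵖ) =
        HSRep c n (Complex.I • (1 + HS.T (-1) i))) := by
  obtain ⟨Φ, hΦ⟩ := exists_hom_NDF hn c
  obtain ⟨K, hK, hKΦ⟩ := exists_faithful_rep hn c hΦ
  have hπ : ∀ i, Φ (HS.π i) = ofNDF (c.sortFun i) := fun i => extRep_ext hn fun k => by
    rw [← hΦ]
    exact (conjOp_eq_iff _ _ _).mpr (extQuotEquiv_π c k.isLt i)
  have hπbar : ∀ i, Φ (HS.πbar i) = ofNDF (c.sortBarFun i) := fun i => extRep_ext hn fun k => by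
    rw [← hΦ]
    exact (conjOp_eq_iff _ _ _).mpr (extQuotEquiv_πbar c k.isLt i)
  have hrange : (MonoidAlgebra.mapDomainAlgHom ℂ ℂ (c.embed n)).range =
      Algebra.adjoin ℂ (Set.range fun i => Φ (HS.π i)) := by
    rw [MonoidAlgebra_range_eq_adjoin _ (closure_NDPF_π n),
      ← (c.idx_surjective n).range_comp]
    congr 2
    funext i
    simp [hπ, Side.embed_π]
  have hmap : (hecke n 0).map Φ = (MonoidAlgebra.mapDomainAlgHom ℂ ℂ (c.embed n)).range := by
    rw [hrange, hecke_zero, AlgHom.map_adjoin, ← Set.range_comp]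
    rfl
  have hcomp : K.comp Φ = HSRep c n := AlgHom.ext hKΦ
  refine ⟨NDFRep_injective hn, ⟨Φ, ?_, ?_, hπ, hπbar, ?_, extEquiv c, ?_, ?_⟩, ?_, ?_⟩
  · rw [← AlgHom.range_eq_top, eq_top_iff]
    have hs : Submonoid.closure (Set.range (Sum.elim piFun piBarFun : _ → NDF n)) = ⊤ := by
      rw [Set.Sum.elim_range, closure_piFun_piBarFun]
    have h := MonoidAlgebra_range_eq_adjoin (AlgHom.id ℂ (MonoidAlgebra ℂ (NDF n))) hs
    rw [(AlgHom.range_eq_top _).mpr Function.surjective_id] at h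
    rw [h, Algebra.adjoin_le_iff]
    -- The two mirror versions exchange which sort is responsible for `p_i` and which for `p̄_i`.
    rintro _ ⟨i | i, rfl⟩ <;> cases c
    · exact ⟨_, hπbar i⟩
    · exact ⟨_, hπ i⟩
    · exact ⟨_, hπ i⟩
    · exact ⟨_, hπbar i⟩
  · ext h
    rw [RingHom.mem_ker, RingHom.mem_ker, ← hKΦ, map_eq_zero_iff K hK]
  · rintro rfl
    exact hmap
  · exact fun k h x => (conjOp_eq_iff _ _ _).mp (hΦ h k) x
  · exact fun k τ x => extQuotEquiv_perm c k.isLt τ x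
  -- The range is `K (Φ (Hₙ(0)))`, which is `ρ (Hₙ(0))` because `K ∘ Φ = ρ`.
  · obtain ⟨ψ, hψ⟩ := exists_equiv_of_range_eq
      (K.comp (MonoidAlgebra.mapDomainAlgHom ℂ ℂ (c.embed n)))
      (hK.comp (MonoidAlgebra.mapDomain_injective (c.embed_injective n)))
      (S := (hecke n 0).map (HSRep c n)) (by
        rw [AlgHom.range_comp, ← hmap, Subalgebra.map_map, hcomp])
    refine ⟨ψ, fun i => ?_⟩
    rw [hψ, ← hKΦ, hπ, ← Side.embed_π]
    simp
  · have hgen : ∀ i, K (tlHom n c.scalar_mul_self (TemperleyLieb.e 0 i)) =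
        HSRep c n (Complex.I • (1 + HS.T (-1) i)) := by
      intro i
      rw [tlHom_e, c.scalar_smul_diffFun, ← hπ, ← hπbar, ← map_sub, ← map_smul, hKΦ,
        one_add_T_neg_one]
    obtain ⟨θ, hθ⟩ := exists_equiv_of_range_eq (K.comp (tlHom n c.scalar_mul_self))
      (hK.comp (tlHom_injective n c.scalar_mul_self))
      (S := (hecke n (-1)).map (HSRep c n)) (by
        rw [hecke_neg_one, AlgHom.map_adjoin, ← Set.range_comp, ← Algebra.map_top,
          ← TemperleyLieb.adjoin_e, AlgHom.map_adjoin, ← Set.range_comp]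
        congr 2
        funext i
        exact hgen i)
    exact ⟨θ, fun i => (hθ _).trans (hgen i)⟩
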